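/- Let $(\Omega,P)$ be a probability space and let $\{X_t;\,t\in\mathbb Z\}$ be a zero mean, second order stationary real process with autocovariance $R_X(h)=\mathrm{Cov}(X_{t+h},X_t)$ and finite fourth moments. Assume that its fourth order joint cumulants $\mathrm{cum}(X_t,X_{t+u_1},X_{t+u_2},X_{t+u_3})$ do not depend on $t$ and are absolutely summable over $(u_1,u_2,u_3)\in\mathbb Z^3$, and that the spectral distribution function $F_X$ of $\{X_t\}$ on $[-\pi,\pi]$ (given by $R_X(h)=\int_{-\pi}^{\pi}e^{-ih\omega}F_X(d\omega)$, $h\in\mathbb Z$) has no jumps. Let $$Y_t=\sum_{j=1}^{J}R_j\cos(\lambda_j t+\phi_j)+X_t,\qquad t\in\mathbb Z,$$ where $R_j,\lambda_j$ are real constants, at least one $R_j$ is nonzero, the $\phi_j$ are independent, uniformly distributed on $(-\pi,\pi)$ and jointly independent of $\{X_t\}$. Assume that, among the indices with $R_j\neq0$, no $\lambda_j$ is an integer multiple of $\pi$, and no two of the $\lambda_j$ are equal up to sign and modulo $2\pi$. Let $F_Y$ be the spectral distribution function of $\{Y_t\}$ on $\Lambda=[-\pi,\pi]$, i.e. $\mathrm{Cov}(Y_{t+h},Y_t)=\int_{-\pi}^{\pi}e^{-ih\omega}F_Y(d\omega)$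 for $h\in\mathbb Z$, and let $\Sigma_Y=F_Y(\pi)=\mathrm{Var}(Y_0)$. No continuity of $F_Y$ is required. For $0\le p\le 1$ let $\lambda_p=\inf\{\omega\in\Lambda:\ F_Y(\omega)\Sigma_Y^{-1}\ge p\}$ be the $p$-th spectral quantile, and assume that it is uniquely determined in the sense that $F_Y(\omega)>p\,\Sigma_Y$ for all $\omega\in\Lambda$ with $\omega>\lambda_p$. From the observations $Y_1,\dots,Y_n$ form, for $|h|<n$, $C_n(h)=\frac1{n-|h|}\sum_{s=1}^{n-|h|}Y_sY_{s+|h|}$, then $I_n^*(\omega)=\sum_{|h|<n}C_n(h)e^{-ih\omega}$ and the smoothed periodogram $$\hat f_Y(\omega)=\frac1{2\pi}\sum_{|h|\le m}\phi\Bigl(\frac hm\Bigr)\int_{-\pi}^{\pi}I_n^*(\lambda)e^{-ih(\omega-\lambda)}\,d\lambda .$$ Here $m=m_n\to\infty$, $m/n\to0$, and the window $\phi:\mathbb R\to\mathbb R$ satisfies $\phi(0)=1$, is continuous at $0$, satisfies $\phi(-\omega)=\phi(\omega)$ and $|\phi(\omega)|\le1$ for $\omega\in\Lambda$, and $\phi(\omega)=0$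 for $|\omega|>1$. With $\rho_p(u)=u\,(p-\mathbf 1(u<0))$, let $\hat\lambda^*_p=\hat\lambda^*_{p,n}$ be any minimizer over $\theta\in\Lambda$ of $$S_n^*(\theta)=\int_{-\pi}^{\pi}\rho_p(\omega-\theta)\hat f_Y(\omega)\,d\omega .$$ Then $\hat\lambda^*_p\to\lambda_p$ in probability as $n\to\infty$. -/

import Mathlib

open MeasureTheory ProbabilityTheory Filter Topology

noncomputable section

namespace SpectralQuantile

/-- The parameter space `Λ = [-π, π]`. -/
def Lam : Set ℝ := Set.Icc (-Real.pi) Real.pi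

/-- The check function `ρ_p(u) = u (p - 1(u < 0))`. -/
def checkFn (p u : ℝ) : ℝ := u * (p - if u < 0 then 1 else 0)

section Proc

variable {Ω : Type*} [MeasurableSpace Ω]

/-- A zero mean, second order stationary, real valued process indexed by `ℤ`. -/
structure IsSecondOrderStationary (P : Measure Ω) (X : ℤ → Ω → ℝ) : Prop where
  measurable : ∀ t, Measurable (X t)
  memLp_two : ∀ t, MemLp (X t) 2 P
  mean_zero : ∀ t, ∫ ω, X t ω ∂P = 0
  cov_shift : ∀ t h : ℤ, covariance (X (t + h)) (X t) P = covariance (X h) (X 0) P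

/-- The autocovariance function `R_X(h) = Cov(X_h, X_0)`. -/
def autocov (P : Measure Ω) (X : ℤ → Ω → ℝ) (h : ℤ) : ℝ :=
  covariance (X h) (X 0) P

/-- The fourth order joint cumulant `cum(A, B, C, D)` (of random variables with finite fourth
moments), written through central moments. -/
def cum4 (P : Measure Ω) (A B C D : Ω → ℝ) : ℝ :=
  ∫ ω, (A ω - ∫ x, A x ∂P) * (B ω - ∫ x, B x ∂P) * (C ω - ∫ x, C x ∂P) * (D ω - ∫ x, D x ∂P) ∂P
    - covariance A B P * covariance C D P
    - covariance A C P * covariance B D P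
    - covariance A D P * covariance B C P

/-- Fourth moments exist, the fourth order joint cumulants
`cum_X(u₁, u₂, u₃) = cum(X_t, X_{t+u₁}, X_{t+u₂}, X_{t+u₃})` do not depend on `t`, and they are
absolutely summable over `ℤ³`. -/
structure HasSummableFourthCumulants (P : Measure Ω) (X : ℤ → Ω → ℝ) : Prop where
  memLp_four : ∀ t, MemLp (X t) 4 P
  cum_shift : ∀ t u₁ u₂ u₃ : ℤ,
    cum4 P (X t) (X (t + u₁)) (X (t + u₂)) (X (t + u₃)) = cum4 P (X 0) (X u₁) (X u₂) (X u₃)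
  summable_cum : Summable fun u : ℤ × ℤ × ℤ => |cum4 P (X 0) (X u.1) (X u.2.1) (X u.2.2)|

/-- Random phases: independent, each uniformly distributed on `(-π, π)`, and jointly independent
of the whole process `X`. -/
structure IsRandomPhase (P : Measure Ω) (X : ℤ → Ω → ℝ) {J : ℕ} (Φ : Fin J → Ω → ℝ) :
    Prop where
  measurable : ∀ j, Measurable (Φ j)
  uniform : ∀ j, pdf.IsUniform (Φ j) (Set.Ioo (-Real.pi) Real.pi) P volume
  indep : iIndepFun Φ P
  indep_process : IndepFun (fun ω j => Φ j ω) (fun ω t => X t ω) P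

/-- The sinusoid model `Y_t = ∑_j R_j cos(λ_j t + φ_j) + X_t`. -/
def sinusoidModel {J : ℕ} (R freq : Fin J → ℝ) (Φ : Fin J → Ω → ℝ) (X : ℤ → Ω → ℝ) :
    ℤ → Ω → ℝ :=
  fun t ω => ∑ j, R j * Real.cos (freq j * t + Φ j ω) + X t ω

end Proc

/-- The frequencies that occur with nonzero amplitude are genuine and pairwise distinct:
none is a multiple of `π`, and no two agree up to sign and modulo `2π`. -/
structure AreProperFrequencies {J : ℕ} (R freq : Fin J → ℝ) : Prop where
  ne_int_mul_pi : ∀ j, R j ≠ 0 → ∀ k : ℤ, freq j ≠ k * Real.pi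
  ne_add : ∀ i j, i ≠ j → R i ≠ 0 → R j ≠ 0 → ∀ k : ℤ, freq i ≠ freq j + k * (2 * Real.pi)
  ne_neg_add : ∀ i j, i ≠ j → R i ≠ 0 → R j ≠ 0 → ∀ k : ℤ,
    freq i ≠ -freq j + k * (2 * Real.pi)

/-- `F` is a spectral measure on `[-π, π]` of the autocovariance function `R`
(Herglotz representation): `R(h) = ∫ e^{-ihω} F(dω)` for all `h ∈ ℤ`. -/
structure IsSpectralMeasure (R : ℤ → ℝ) (F : Measure ℝ) : Prop where
  finite : IsFiniteMeasure F
  support : F Lamᶜ = 0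
  herglotz : ∀ h : ℤ, (R h : ℂ) = ∫ x : ℝ, Complex.exp (-Complex.I * h * x) ∂F

/-- The spectral distribution function `F(ω)`. -/
def spectralCDF (F : Measure ℝ) (x : ℝ) : ℝ := F.real (Set.Icc (-Real.pi) x)

/-- The `p`th quantile `λ_p = inf {ω ∈ Λ ; F(ω) Σ⁻¹ ≥ p}`, with `Σ = F(π)` (equal to `R(0)`). -/
def spectralQuantile (F : Measure ℝ) (p : ℝ) : ℝ :=
  sInf {x | x ∈ Lam ∧ p ≤ spectralCDF F x * (spectralCDF F Real.pi)⁻¹}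

/-- The sample autocovariance `C_n(h) = (n - |h|)⁻¹ ∑_{s=1}^{n-|h|} y_s y_{s+|h|}` (used for
`|h| < n`) of a trajectory `y`. -/
def sampleAutocov (y : ℤ → ℝ) (n : ℕ) (h : ℤ) : ℝ :=
  ((n : ℝ) - (h.natAbs : ℝ))⁻¹ *
    ∑ s ∈ Finset.Icc 1 (n - h.natAbs), y (s : ℤ) * y ((s : ℤ) + (h.natAbs : ℤ))

/-- `I*_n(x) = ∑_{|h| < n} C_n(h) e^{-ihx}`. -/
def extPeriodogram (y : ℤ → ℝ) (n : ℕ) (x : ℝ) : ℂ :=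
  ∑ h ∈ Finset.Ioo (-(n : ℤ)) n, (sampleAutocov y n h : ℂ) * Complex.exp (-Complex.I * h * x)

/-- The smoothed periodogram
`f̂(ω) = (2π)⁻¹ ∑_{|h| ≤ m} φ(h/m) ∫_{-π}^{π} I*_n(x) e^{-ih(ω - x)} dx`. -/
def smoothedPeriodogram (φ : ℝ → ℝ) (m : ℕ) (y : ℤ → ℝ) (n : ℕ) (w : ℝ) : ℂ :=
  (1 / (2 * (Real.pi : ℂ))) * ∑ h ∈ Finset.Icc (-(m : ℤ)) m, (φ ((h : ℝ) / m) : ℂ) *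
    ∫ x in (-Real.pi)..Real.pi, extPeriodogram y n x * Complex.exp (-Complex.I * h * (w - x))

/-- The objective function `S*_n(θ) = ∫_{-π}^{π} ρ_p(ω - θ) f̂(ω) dω`. The smoothed periodogram is
real valued when `φ` is even on `[-1, 1]`, so that `re` is only the passage from `ℂ` to `ℝ`. -/
def objective (φ : ℝ → ℝ) (m : ℕ) (p : ℝ) (y : ℤ → ℝ) (n : ℕ) (θ : ℝ) : ℝ :=
  ∫ w in (-Real.pi)..Real.pi, checkFn p (w - θ) * (smoothedPeriodogram φ m y n w).re

/-- The assumptions on the window function `φ` and on the truncation points `m = m_n`. -/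
structure IsWindow (φ : ℝ → ℝ) (m : ℕ → ℕ) : Prop where
  m_tendsto : Tendsto m atTop atTop
  m_div_tendsto : Tendsto (fun n => (m n : ℝ) / n) atTop (𝓝 0)
  at_zero : φ 0 = 1
  continuousAt_zero : ContinuousAt φ 0
  even : ∀ x ∈ Lam, φ (-x) = φ x
  abs_le_one : ∀ x ∈ Lam, |φ x| ≤ 1
  support : ∀ x, 1 < |x| → φ x = 0

end SpectralQuantile

end

noncomputable section

namespace SpectralQuantile

/-! The argument is uniform convergence of objectives plus a well separated minimizer; it is carried
out on the autocovariances and needs no spectral density. By orthogonality of the exponentials, for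
`m < n` the objective is a finite sum over the lags `h` of `φ(h/m) C_n(h) c_h(θ)`, where `c_h(θ)` is
the cosine coefficient of the check function centred at `θ` (`objective_eq`). The kink of the check
function makes `c_h(θ)` of order `h⁻²` uniformly in `θ`, so the sup distance between the objective
and `∑ R_Y(h) c_h(θ)` is at most a summably weighted sum of the errors `|φ(h/m) C_n(h) - R_Y(h)|`
(`enorm_objective_sub_le`). Dominated convergence over the lags then asks only for convergence in
mean at each fixed lag and a bound uniform in `n` and `h` (`tendsto_lintegral_distance`).

At a fixed lag (`isL1Null_sinusoid_average`), products of sinusoids average out by geometric sums,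
except for the diagonal, which gives `R_j² cos(λ_j h) / 2`. Cross terms and noise products are
controlled in mean square through Wiener's theorem for the atomless `F_X` and through summability of
the cumulants.

The limit is identified by summing the cosine series: it is `π` times `∫ |w - θ| + (1 - 2p) θ dF_Y`,
once `F_Y` is known to be symmetric (`hasSum_autocov_mul_checkCoeff`). The Herglotz formula cannot
tell `π` from `-π`, so symmetry first requires that `F_Y` has no mass there
(`spectral_mass_pi_eq_zero`). The limit is a quantile check loss: convex, with one-sided slopes
governed by `F_Y - p Σ_Y`, so the unique quantile is its only minimizer on `Λ`; compactness gives a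
gap. -/

/-! ### Cosine coefficients of the check function -/

lemma continuous_checkFn (p : ℝ) : Continuous (checkFn p) := by
  have : checkFn p = fun u => |u| / 2 + (p - 1 / 2) * u := by
    ext u
    unfold checkFn
    split_ifs with h
    · rw [abs_of_neg h]; ring
    · rw [abs_of_nonneg (not_lt.mp h)]; ring
  rw [this]; fun_prop

/-- The cosine coefficients of `w ↦ ρ_p (w - θ)` on `[-π, π]`. -/
def checkCoeff (p : ℝ) (h : ℤ) (θ : ℝ) : ℝ :=
  ∫ w in (-Real.pi)..Real.pi, checkFn p (w - θ) * Real.cos (h * w)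

lemma integral_checkFn_mul {p θ : ℝ} (hθ : θ ∈ Lam) {g : ℝ → ℝ} (hg : Continuous g) :
    ∫ w in (-Real.pi)..Real.pi, checkFn p (w - θ) * g w =
      (p - 1) * (∫ w in (-Real.pi)..θ, (w - θ) * g w) +
        p * ∫ w in θ..Real.pi, (w - θ) * g w := by
  have hc : Continuous fun w => checkFn p (w - θ) * g w :=
    ((continuous_checkFn p).comp (by fun_prop)).mul hg
  rw [← intervalIntegral.integral_add_adjacent_intervals (hc.intervalIntegrable _ θ)
    (hc.intervalIntegrable _ _), ← intervalIntegral.integral_const_mul,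
    ← intervalIntegral.integral_const_mul]
  congr 1
  · refine intervalIntegral.integral_congr fun w hw => ?_
    rw [Set.uIcc_of_le hθ.1] at hw
    rcases hw.2.eq_or_lt with h | h
    · simp [checkFn, h]
    · simp only [checkFn, if_pos (sub_neg.mpr h)]; ring
  · refine intervalIntegral.integral_congr fun w hw => ?_
    rw [Set.uIcc_of_le hθ.2] at hw
    simp only [checkFn, if_neg (not_lt.mpr (sub_nonneg.mpr hw.1))]; ring

lemma checkCoeff_zero {p θ : ℝ} (hθ : θ ∈ Lam) :
    checkCoeff p 0 θ = Real.pi ^ 2 / 2 + θ ^ 2 / 2 + Real.pi * θ * (1 - 2 * p) := by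
  have hF : ∀ a b : ℝ, ∫ w in a..b, (w - θ) * Real.cos ((0 : ℤ) * w) =
      (b - θ) ^ 2 / 2 - (a - θ) ^ 2 / 2 := by
    intro a b
    refine intervalIntegral.integral_eq_sub_of_hasDerivAt (f := fun w => (w - θ) ^ 2 / 2)
      (fun w _ => ?_) ((by fun_prop : Continuous _).intervalIntegrable _ _)
    have h := (((hasDerivAt_id w).sub_const θ).pow 2).div_const 2
    convert! h using 1
    simp
  rw [checkCoeff, integral_checkFn_mul hθ (by fun_prop), hF, hF]
  ring

/-- Integration by parts on the two linear pieces: the boundary sines vanish at `±π`, and the level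
`p` drops out because only the jump `p - (p - 1) = 1` of the slope at `θ` matters. The decay `h⁻²`
is what makes everything summable over the lags. -/
lemma checkCoeff_of_ne_zero {p θ : ℝ} (hθ : θ ∈ Lam) {h : ℤ} (hh : h ≠ 0) :
    checkCoeff p h θ = (Real.cos (h * Real.pi) - Real.cos (h * θ)) / (h : ℝ) ^ 2 := by
  have hh' : (h : ℝ) ≠ 0 := Int.cast_ne_zero.mpr hh
  have hF : ∀ a b : ℝ, ∫ w in a..b, (w - θ) * Real.cos (h * w) =
      ((b - θ) * Real.sin (h * b) / h + Real.cos (h * b) / h ^ 2) -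
        ((a - θ) * Real.sin (h * a) / h + Real.cos (h * a) / h ^ 2) := by
    intro a b
    refine intervalIntegral.integral_eq_sub_of_hasDerivAt
      (f := fun w => (w - θ) * Real.sin (h * w) / h + Real.cos (h * w) / h ^ 2)
      (fun w _ => ?_) ((by fun_prop : Continuous _).intervalIntegrable _ _)
    have e : HasDerivAt (fun w : ℝ => (h : ℝ) * w) h w := by
      simpa using (hasDerivAt_id w).const_mul (h : ℝ)
    have h1 := ((((hasDerivAt_id w).sub_const θ).mul e.sin).div_const (h : ℝ)).add
      (e.cos.div_const ((h : ℝ) ^ 2))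
    convert! h1 using 1
    simp
    field_simp
    ring
  have hs : Real.sin (h * Real.pi) = 0 := Real.sin_int_mul_pi h
  have hs' : Real.sin (h * -Real.pi) = 0 := by rw [mul_neg, Real.sin_neg, hs, neg_zero]
  have hc' : Real.cos (h * -Real.pi) = Real.cos (h * Real.pi) := by rw [mul_neg, Real.cos_neg]
  rw [checkCoeff, integral_checkFn_mul hθ (by fun_prop), hF, hF, hs, hs', hc']
  ring

/-- A summable bound for `checkCoeff p h θ`, uniform in `θ ∈ [-π, π]`. -/
def checkWeight (h : ℤ) : ℝ := if h = 0 then 4 * Real.pi ^ 2 else 2 / (h : ℝ) ^ 2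

lemma summable_checkWeight : Summable checkWeight := by
  have h1 : Summable fun h : ℤ => 2 * (1 / (h : ℝ) ^ 2) :=
    (Real.summable_one_div_int_pow.mpr one_lt_two).mul_left 2
  refine (h1.add (hasSum_ite_eq (0 : ℤ) (4 * Real.pi ^ 2)).summable).congr fun h => ?_
  unfold checkWeight
  split_ifs with hh
  · simp [hh]
  · ring

lemma abs_checkCoeff_le {p θ : ℝ} (hp : p ∈ Set.Icc (0 : ℝ) 1) (hθ : θ ∈ Lam) (h : ℤ) :
    |checkCoeff p h θ| ≤ checkWeight h := by
  unfold checkWeight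
  split_ifs with hh
  · subst hh
    rw [checkCoeff_zero hθ]
    have hpi := Real.pi_pos
    obtain ⟨h1, h2⟩ := hθ
    obtain ⟨h3, h4⟩ := hp
    have h5 : |θ| ≤ Real.pi := abs_le.mpr ⟨h1, h2⟩
    have h6 : |1 - 2 * p| ≤ 1 := abs_le.mpr ⟨by linarith, by linarith⟩
    have h7 : θ ^ 2 ≤ Real.pi ^ 2 := sq_le_sq' h1 h2
    have h8 : |Real.pi * θ * (1 - 2 * p)| ≤ Real.pi * Real.pi * 1 := by
      rw [abs_mul, abs_mul, abs_of_pos hpi]; gcongr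
    have := abs_le.mp h8
    rw [abs_le]
    constructor <;> nlinarith [sq_nonneg θ]
  · rw [checkCoeff_of_ne_zero hθ hh, abs_div, abs_of_nonneg (sq_nonneg (h : ℝ))]
    gcongr
    calc _ ≤ |Real.cos (h * Real.pi)| + |Real.cos (h * θ)| := abs_sub _ _
      _ ≤ 1 + 1 := add_le_add (Real.abs_cos_le_one _) (Real.abs_cos_le_one _)
      _ = 2 := by norm_num

/-- This is the Fourier series of the Bernoulli polynomial `X² - X + 1/6` at `|x| / 2π`. The term at
`n = 0` is zero by the convention for division by zero. -/
lemma hasSum_cos_div_sq {x : ℝ} (hx : |x| ≤ 2 * Real.pi) :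
    HasSum (fun n : ℕ => Real.cos (n * x) / (n : ℝ) ^ 2)
      (Real.pi ^ 2 / 6 - Real.pi * |x| / 2 + x ^ 2 / 4) := by
  have hpi := Real.pi_pos
  have h := hasSum_one_div_nat_pow_mul_cos (k := 1) one_ne_zero (x := |x| / (2 * Real.pi))
    ⟨by positivity, by rw [div_le_one (by positivity)]; exact hx⟩
  convert! h using 1
  · ext n
    have : 2 * Real.pi * n * (|x| / (2 * Real.pi)) = n * |x| := by field_simp
    rw [this]
    have : Real.cos (n * |x|) = Real.cos (n * x) := by
      rcases abs_choice x with h | h <;> rw [h]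
      rw [mul_neg, Real.cos_neg]
    rw [this]; ring
  · have h2 : Polynomial.bernoulli 2 = Polynomial.X ^ 2 - Polynomial.X + Polynomial.C (1 / 6) := by
      rw [Polynomial.bernoulli]
      simp [Finset.sum_range_succ, ← Polynomial.C_mul_X_pow_eq_monomial, bernoulli_two,
        bernoulli_one]
      have : (Polynomial.C (-1 / 2) : Polynomial ℚ) * 2 = -1 := by
        rw [← map_ofNat (Polynomial.C : ℚ →+* Polynomial ℚ) 2, ← map_mul]
        norm_num
      linear_combination Polynomial.X * this
    rw [mul_one, h2]
    simp [Nat.factorial]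
    field_simp
    linear_combination (-24) * sq_abs x

lemma hasSum_int_cos_div_sq {x : ℝ} (hx : |x| ≤ 2 * Real.pi) :
    HasSum (fun n : ℤ => Real.cos (n * x) / (n : ℝ) ^ 2)
      (Real.pi ^ 2 / 3 - Real.pi * |x| + x ^ 2 / 2) := by
  have h := hasSum_cos_div_sq hx
  have h2 := HasSum.of_nat_of_neg (f := fun n : ℤ => Real.cos (n * x) / (n : ℝ) ^ 2)
    (by simpa using h) (by simpa using h)
  convert! h2 using 1
  simp
  ring

lemma hasSum_cos_mul_cos_div_sq {θ w : ℝ} (hθ : θ ∈ Lam) (hw : w ∈ Lam) :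
    HasSum (fun n : ℤ => Real.cos (n * θ) * Real.cos (n * w) / (n : ℝ) ^ 2)
      (Real.pi ^ 2 / 3 - Real.pi / 2 * (|w - θ| + |w + θ|) + (θ ^ 2 + w ^ 2) / 2) := by
  obtain ⟨h1, h2⟩ := hθ
  obtain ⟨h3, h4⟩ := hw
  have ha := hasSum_int_cos_div_sq (x := w - θ) (abs_le.mpr ⟨by linarith, by linarith⟩)
  have hb := hasSum_int_cos_div_sq (x := w + θ) (abs_le.mpr ⟨by linarith, by linarith⟩)
  convert! (ha.add hb).mul_left (1 / 2) using 1
  · ext n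
    rw [mul_sub, mul_add (n : ℝ), Real.cos_sub, Real.cos_add]
    ring
  · ring

/-- A cosine series sees only the even part: the sum is `π (ρ_p(w - θ) + ρ_p(-w - θ))`. -/
lemma hasSum_checkCoeff_mul_cos {p θ w : ℝ} (hθ : θ ∈ Lam) (hw : w ∈ Lam) :
    HasSum (fun n : ℤ => checkCoeff p n θ * Real.cos (n * w))
      (Real.pi * θ * (1 - 2 * p) + Real.pi / 2 * (|w - θ| + |w + θ|)) := by
  have hpi := Real.pi_pos
  have hπ : Real.pi ∈ Lam := ⟨by linarith, le_rfl⟩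
  -- The coefficient at lag zero is added separately, since the `1 / n²` series contribute nothing
  -- there. The constants `cos (nπ)` come from the product series with `π` in place of `θ`.
  have h0 := hasSum_ite_eq (0 : ℤ) (checkCoeff p 0 θ)
  have h := h0.add ((hasSum_cos_mul_cos_div_sq hπ hw).sub (hasSum_cos_mul_cos_div_sq hθ hw))
  convert! h using 1
  · ext n
    split_ifs with hn
    · simp [hn]
    · rw [checkCoeff_of_ne_zero hθ hn]; ring
  · rw [checkCoeff_zero hθ, abs_of_nonneg (by linarith [hw.1] : 0 ≤ w + Real.pi),
      abs_of_nonpos (by linarith [hw.2] : w - Real.pi ≤ 0)]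
    ring

/-! ### The objective as a finite sum over lags -/

lemma integral_exp_int_mul (j : ℤ) :
    ∫ x in (-Real.pi)..Real.pi, Complex.exp (Complex.I * j * x) =
      if j = 0 then 2 * (Real.pi : ℂ) else 0 := by
  split_ifs with hj
  · simp only [hj, Int.cast_zero, mul_zero, zero_mul, Complex.exp_zero,
      intervalIntegral.integral_const, sub_neg_eq_add, Complex.real_smul, mul_one]
    push_cast; ring
  · have hc : Complex.I * (j : ℂ) ≠ 0 := mul_ne_zero Complex.I_ne_zero (Int.cast_ne_zero.mpr hj)
    rw [integral_exp_mul_complex hc, div_eq_zero_iff, sub_eq_zero]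
    left
    rw [Complex.exp_eq_exp_iff_exists_int]
    exact ⟨j, by push_cast; ring⟩

lemma integral_extPeriodogram_mul_exp (y : ℤ → ℝ) {n : ℕ} {h : ℤ} (hh : h ∈ Finset.Ioo (-(n : ℤ)) n)
    (w : ℝ) :
    ∫ x in (-Real.pi)..Real.pi, extPeriodogram y n x * Complex.exp (-Complex.I * h * (w - x)) =
      2 * (Real.pi : ℂ) * (sampleAutocov y n h * Complex.exp (-Complex.I * h * w)) := by
  have e : ∀ x : ℝ, extPeriodogram y n x * Complex.exp (-Complex.I * h * (w - x)) =
      ∑ k ∈ Finset.Ioo (-(n : ℤ)) n, (sampleAutocov y n k * Complex.exp (-Complex.I * h * w)) *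
        Complex.exp (Complex.I * ((h - k : ℤ) : ℂ) * x) := by
    intro x
    rw [extPeriodogram, Finset.sum_mul]
    refine Finset.sum_congr rfl fun k _ => ?_
    rw [mul_assoc (sampleAutocov y n k : ℂ), mul_assoc (sampleAutocov y n k : ℂ),
      ← Complex.exp_add, ← Complex.exp_add]
    congr 2
    push_cast; ring
  simp_rw [e]
  rw [intervalIntegral.integral_finsetSum
    fun k _ => (by fun_prop : Continuous _).intervalIntegrable _ _]
  simp_rw [intervalIntegral.integral_const_mul, integral_exp_int_mul, sub_eq_zero]
  rw [Finset.sum_eq_single_of_mem h hh fun k _ hk => by simp [hk.symm]]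
  simp [mul_comm]

lemma smoothedPeriodogram_re (φ : ℝ → ℝ) {m n : ℕ} (hmn : m < n) (y : ℤ → ℝ) (w : ℝ) :
    (smoothedPeriodogram φ m y n w).re = ∑ h ∈ Finset.Icc (-(m : ℤ)) m,
      φ ((h : ℝ) / m) * sampleAutocov y n h * Real.cos (h * w) := by
  have e : smoothedPeriodogram φ m y n w = ∑ h ∈ Finset.Icc (-(m : ℤ)) m,
      ((φ ((h : ℝ) / m) * sampleAutocov y n h : ℝ) : ℂ) *
        Complex.exp (((-(h * w) : ℝ) : ℂ) * Complex.I) := by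
    rw [smoothedPeriodogram, Finset.mul_sum]
    refine Finset.sum_congr rfl fun h hh => ?_
    rw [Finset.mem_Icc] at hh
    rw [integral_extPeriodogram_mul_exp y (Finset.mem_Ioo.mpr ⟨by omega, by omega⟩)]
    have hpi : (Real.pi : ℂ) ≠ 0 := Complex.ofReal_ne_zero.mpr Real.pi_ne_zero
    have : -Complex.I * h * w = ((-(h * w) : ℝ) : ℂ) * Complex.I := by push_cast; ring
    rw [this]
    push_cast
    field_simp
  rw [e, Complex.re_sum]
  refine Finset.sum_congr rfl fun h _ => ?_
  rw [Complex.re_ofReal_mul, Complex.exp_ofReal_mul_I_re, Real.cos_neg]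

/-- Data and parameter separate: `θ` enters only through deterministic coefficients. The condition
`m < n` puts every lag of the window inside the periodogram. -/
lemma objective_eq (φ : ℝ → ℝ) {m n : ℕ} (hmn : m < n) (p : ℝ) (y : ℤ → ℝ) (θ : ℝ) :
    objective φ m p y n θ = ∑ h ∈ Finset.Icc (-(m : ℤ)) m,
      φ ((h : ℝ) / m) * sampleAutocov y n h * checkCoeff p h θ := by
  have hc := (continuous_checkFn p).comp (by fun_prop : Continuous fun w : ℝ => w - θ)
  simp only [Function.comp_def] at hc
  have e : ∀ w : ℝ, checkFn p (w - θ) * (smoothedPeriodogram φ m y n w).re =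
      ∑ h ∈ Finset.Icc (-(m : ℤ)) m, φ ((h : ℝ) / m) * sampleAutocov y n h *
        (checkFn p (w - θ) * Real.cos (h * w)) := by
    intro w
    rw [smoothedPeriodogram_re φ hmn, Finset.mul_sum]
    exact Finset.sum_congr rfl fun h _ => by ring
  simp_rw [objective, e]
  rw [intervalIntegral.integral_finsetSum
    fun k _ => (by fun_prop : Continuous _).intervalIntegrable _ _]
  simp_rw [intervalIntegral.integral_const_mul]
  rfl

/-! ### The limit objective and its minimizer -/

/-- The limit, up to the factor `π`, of the objective functions. -/
def limitObjective (F : Measure ℝ) (p θ : ℝ) : ℝ := ∫ w, |w - θ| + (1 - 2 * p) * θ ∂F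

section Quantile

variable {F : Measure ℝ}

lemma ae_mem_Lam (hF : F Lamᶜ = 0) : ∀ᵐ w ∂F, w ∈ Lam := by
  rwa [ae_iff]

lemma spectralQuantile_mem (hpos : 0 < spectralCDF F Real.pi) {p : ℝ}
    (hp : p ≤ 1) : spectralQuantile F p ∈ Lam := by
  have hpi := Real.pi_pos
  have hbdd : ∀ x ∈ {x | x ∈ Lam ∧ p ≤ spectralCDF F x * (spectralCDF F Real.pi)⁻¹},
      -Real.pi ≤ x := fun x hx => hx.1.1
  have hmem : Real.pi ∈ {x | x ∈ Lam ∧ p ≤ spectralCDF F x * (spectralCDF F Real.pi)⁻¹} :=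
    ⟨⟨by linarith, le_rfl⟩, by rwa [mul_inv_cancel₀ hpos.ne']⟩
  exact ⟨le_csInf ⟨_, hmem⟩ hbdd, csInf_le ⟨_, hbdd⟩ hmem⟩

lemma spectralCDF_lt_of_lt_spectralQuantile (hpos : 0 < spectralCDF F Real.pi) {p x : ℝ}
    (hx : x ∈ Lam) (h : x < spectralQuantile F p) :
    spectralCDF F x < p * spectralCDF F Real.pi := by
  by_contra! hc
  refine h.not_ge (csInf_le ⟨-Real.pi, fun x hx => hx.1.1⟩ ⟨hx, ?_⟩)
  rwa [← div_eq_mul_inv, le_div_iff₀ hpos]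

lemma spectralCDF_pi (hF : F Lamᶜ = 0) : spectralCDF F Real.pi = F.real Set.univ := by
  refine measureReal_congr ?_
  filter_upwards [ae_mem_Lam hF] with w hw
  exact eq_true (p := w ∈ Lam) hw

variable [IsFiniteMeasure F]

lemma integrable_of_continuous_of_support (hF : F Lamᶜ = 0) {g : ℝ → ℝ} (hg : Continuous g) :
    Integrable g F := by
  obtain ⟨C, hC⟩ := (isCompact_Icc (a := -Real.pi) (b := Real.pi)).exists_bound_of_continuousOn
    hg.continuousOn
  refine Integrable.of_bound hg.aestronglyMeasurable C ?_
  filter_upwards [ae_mem_Lam hF] with w hw using hC w hw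

lemma integral_step_eq (hF : F Lamᶜ = 0) (t c : ℝ) :
    ∫ w, c * (2 * (Set.Iic t).indicator 1 w - 1) ∂F =
      c * (2 * spectralCDF F t - spectralCDF F Real.pi) := by
  have h1 : Integrable ((Set.Iic t).indicator (1 : ℝ → ℝ)) F :=
    (integrable_const (1 : ℝ)).indicator measurableSet_Iic
  rw [integral_const_mul, integral_sub (h1.const_mul 2) (integrable_const _), integral_const_mul,
    integral_indicator_one measurableSet_Iic, spectralCDF_pi hF]
  have : F.real (Set.Iic t) = spectralCDF F t := by
    refine measureReal_congr ?_
    filter_upwards [ae_mem_Lam hF] with w hw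
    exact propext ⟨fun h => ⟨hw.1, h⟩, fun h => h.2⟩
  rw [this]
  simp

lemma limitObjective_sub (hF : F Lamᶜ = 0) (p s t : ℝ) :
    limitObjective F p t - limitObjective F p s =
      (∫ w, |w - t| - |w - s| ∂F) + (1 - 2 * p) * (t - s) * spectralCDF F Real.pi := by
  have hi : ∀ t : ℝ, Integrable (fun w => |w - t|) F := fun t =>
    integrable_of_continuous_of_support hF (by fun_prop)
  rw [limitObjective, limitObjective, integral_add (hi t) (integrable_const _),
    integral_add (hi s) (integrable_const _), integral_sub (hi t) (hi s), spectralCDF_pi hF]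
  simp
  ring

/-- A convex function lies above its tangents, with right slope `2 (F(s) - p Σ)` at `s`. Pointwise,
`|w - t| - |w - s|` equals `t - s` for `w ≤ s` and is at least `-(t - s)` otherwise. -/
lemma le_limitObjective_sub (hF : F Lamᶜ = 0) (p : ℝ) {s t : ℝ} (hst : s ≤ t) :
    2 * (t - s) * (spectralCDF F s - p * spectralCDF F Real.pi) ≤
      limitObjective F p t - limitObjective F p s := by
  have h : ∫ w, (t - s) * (2 * (Set.Iic s).indicator 1 w - 1) ∂F ≤ ∫ w, |w - t| - |w - s| ∂F := by
    refine integral_mono ?_ (integrable_of_continuous_of_support hF (by fun_prop)) fun w => ?_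
    · exact ((((integrable_const (1 : ℝ)).indicator measurableSet_Iic).const_mul 2).sub
        (integrable_const _)).const_mul _
    · simp only [Set.indicator_apply, Set.mem_Iic, Pi.one_apply]
      split_ifs with h
      · rw [abs_of_nonpos (by linarith), abs_of_nonpos (by linarith)]; linarith
      · have := abs_sub_abs_le_abs_sub (w - s) (w - t)
        rw [show w - s - (w - t) = t - s by ring, abs_of_nonneg (sub_nonneg.mpr hst)] at this
        linarith
  rw [integral_step_eq hF] at h
  rw [limitObjective_sub hF]
  linarith

/-- The companion bound, with the slope taken at the right end point `t`. Both bounds allow jumps of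
the distribution function. -/
lemma limitObjective_sub_le (hF : F Lamᶜ = 0) (p : ℝ) {s t : ℝ} (hst : s ≤ t) :
    limitObjective F p t - limitObjective F p s ≤
      2 * (t - s) * (spectralCDF F t - p * spectralCDF F Real.pi) := by
  have h : ∫ w, |w - t| - |w - s| ∂F ≤ ∫ w, (t - s) * (2 * (Set.Iic t).indicator 1 w - 1) ∂F := by
    refine integral_mono (integrable_of_continuous_of_support hF (by fun_prop)) ?_ fun w => ?_
    · exact ((((integrable_const (1 : ℝ)).indicator measurableSet_Iic).const_mul 2).sub
        (integrable_const _)).const_mul _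
    · simp only [Set.indicator_apply, Set.mem_Iic, Pi.one_apply]
      split_ifs with h
      · have := abs_sub_abs_le_abs_sub (w - t) (w - s)
        rw [show w - t - (w - s) = -(t - s) by ring, abs_neg,
          abs_of_nonneg (sub_nonneg.mpr hst)] at this
        linarith
      · rw [abs_of_nonneg (by linarith), abs_of_nonneg (by linarith)]; linarith
  rw [integral_step_eq hF] at h
  rw [limitObjective_sub hF]
  linarith

lemma continuous_limitObjective (hF : F Lamᶜ = 0) (p : ℝ) : Continuous (limitObjective F p) := by
  have hS : ∀ t, 0 ≤ spectralCDF F t := fun t => measureReal_nonneg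
  have hS' : ∀ t, spectralCDF F t ≤ spectralCDF F Real.pi := fun t => by
    rw [spectralCDF_pi hF]; exact measureReal_mono (Set.subset_univ _)
  set S := spectralCDF F Real.pi
  refine LipschitzWith.continuous (K := Real.toNNReal (2 * (S + |p| * S))) ?_
  refine LipschitzWith.of_le_add_mul _ fun s t => ?_
  have hSp := hS Real.pi
  rw [Real.coe_toNNReal _ (by positivity), Real.dist_eq]
  have key : ∀ t, |spectralCDF F t - p * S| ≤ S + |p| * S := fun t => by
    refine (abs_sub _ _).trans ?_
    rw [abs_mul, abs_of_nonneg (hS t), abs_of_nonneg hSp]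
    gcongr
    exact hS' t
  rcases le_total s t with h | h
  · have h1 := le_limitObjective_sub hF p h
    have h2 := (abs_le.mp (key s)).1
    rw [abs_of_nonpos (sub_nonpos.mpr h)]
    nlinarith
  · have h1 := limitObjective_sub_le hF p h
    have h2 := (abs_le.mp (key s)).2
    rw [abs_of_nonneg (sub_nonneg.mpr h)]
    nlinarith

/-- The spectral quantile is the only minimizer of the limit objective on `[-π, π]`. -/
lemma limitObjective_spectralQuantile_lt (hF : F Lamᶜ = 0) (hpos : 0 < spectralCDF F Real.pi)
    {p : ℝ} (hp : p ≤ 1)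
    (huniq : ∀ x ∈ Lam, spectralQuantile F p < x →
      p * spectralCDF F Real.pi < spectralCDF F x)
    {θ : ℝ} (hθ : θ ∈ Lam) (hne : θ ≠ spectralQuantile F p) :
    limitObjective F p (spectralQuantile F p) < limitObjective F p θ := by
  have hl := spectralQuantile_mem hpos hp
  set l := spectralQuantile F p with hldef
  have hc := continuous_limitObjective hF p
  rcases lt_or_gt_of_ne hne with h | h
  -- Below the quantile the slope is negative, but at `l` itself a jump can spoil the upper bound.
  -- So `l` is reached by continuity from the left, and an intermediate `s` keeps the inequality
  -- strict in the limit.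
  · have anti : ∀ s ∈ Set.Ico θ l, ∀ t ∈ Set.Ico θ l, s < t →
        limitObjective F p t < limitObjective F p s := fun s hs t ht hst => by
      have h1 := limitObjective_sub_le hF p hst.le
      have h2 := spectralCDF_lt_of_lt_spectralQuantile hpos
        (⟨hθ.1.trans ht.1, ht.2.le.trans hl.2⟩ : t ∈ Lam) ht.2
      nlinarith
    obtain ⟨s, hs1, hs2⟩ := exists_between h
    refine lt_of_le_of_lt (b := limitObjective F p s) ?_
      (anti _ ⟨le_rfl, h⟩ _ ⟨hs1.le, hs2⟩ hs1)
    refine le_of_tendsto (hc.tendsto l |>.mono_left nhdsWithin_le_nhds :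
      Tendsto _ (𝓝[<] l) _) ?_
    filter_upwards [Ioo_mem_nhdsLT hs2] with t ht
    exact (anti s ⟨hs1.le, hs2⟩ t ⟨hs1.le.trans ht.1.le, ht.2⟩ ht.1).le
  -- Above the quantile the uniqueness assumption gives a positive slope; `l` is again reached by
  -- continuity, now from the right.
  · have mono : ∀ s ∈ Set.Ioc l θ, ∀ t ∈ Set.Ioc l θ, s < t →
        limitObjective F p s < limitObjective F p t := fun s hs t ht hst => by
      have h1 := le_limitObjective_sub hF p hst.le
      have h2 := huniq s ⟨hl.1.trans hs.1.le, hs.2.trans hθ.2⟩ hs.1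
      nlinarith
    obtain ⟨s, hs1, hs2⟩ := exists_between h
    refine lt_of_le_of_lt (b := limitObjective F p s) ?_
      (mono _ ⟨hs1, hs2.le⟩ _ ⟨h, le_rfl⟩ hs2)
    refine le_of_tendsto (hc.tendsto l |>.mono_left nhdsWithin_le_nhds :
      Tendsto _ (𝓝[>] l) _) ?_
    filter_upwards [Ioo_mem_nhdsGT hs1] with t ht
    exact (mono t ⟨ht.1, ht.2.le.trans hs2.le⟩ s ⟨hs1, hs2.le⟩ ht.2).le

/-- The unique minimizer is well separated. -/
lemma exists_limitObjective_gap (hF : F Lamᶜ = 0) (hpos : 0 < spectralCDF F Real.pi)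
    {p : ℝ} (hp : p ≤ 1)
    (huniq : ∀ x ∈ Lam, spectralQuantile F p < x →
      p * spectralCDF F Real.pi < spectralCDF F x) {ε : ℝ} (hε : 0 < ε) :
    ∃ δ > 0, ∀ θ ∈ Lam, ε ≤ |θ - spectralQuantile F p| →
      limitObjective F p (spectralQuantile F p) + δ ≤ limitObjective F p θ := by
  set l := spectralQuantile F p
  have hc := continuous_limitObjective hF p
  have hK : IsCompact (Lam ∩ {θ | ε ≤ |θ - l|}) :=
    isCompact_Icc.inter_right (isClosed_le continuous_const (by fun_prop))
  rcases (Lam ∩ {θ | ε ≤ |θ - l|}).eq_empty_or_nonempty with h | h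
  · exact ⟨1, one_pos, fun θ h1 h2 => (h.subset ⟨h1, h2⟩).elim⟩
  · obtain ⟨x, hx, hmin⟩ := hK.exists_isMinOn h hc.continuousOn
    have hne : x ≠ l := by
      rintro rfl
      have := hx.2
      simp at this
      linarith
    refine ⟨limitObjective F p x - limitObjective F p l, sub_pos.mpr
      (limitObjective_spectralQuantile_lt hF hpos hp huniq hx.1 hne), fun θ h1 h2 => ?_⟩
    have : limitObjective F p x ≤ limitObjective F p θ := hmin ⟨h1, h2⟩
    linarith

end Quantile

/-! ### Spectral measures on the circle and their symmetry -/

lemma fact_two_pi_pos : Fact (0 < 2 * Real.pi) := ⟨Real.two_pi_pos⟩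

attribute [local instance] fact_two_pi_pos

/-- A finite measure on the circle is determined by its Fourier coefficients. -/
lemma measure_ext_of_integral_fourier {T : ℝ} [Fact (0 < T)] {μ ν : Measure (AddCircle T)}
    [IsFiniteMeasure μ] [IsFiniteMeasure ν]
    (h : ∀ k : ℤ, ∫ x, fourier k x ∂μ = ∫ x, fourier k x ∂ν) : μ = ν := by
  -- Trigonometric polynomials form a star subalgebra that separates points, which determines finite
  -- measures; by linearity, agreement on the monomials suffices.
  let A : StarSubalgebra ℂ (BoundedContinuousFunction (AddCircle T) ℂ) :=
    (fourierSubalgebra (T := T)).comap (BoundedContinuousFunction.toContinuousMapStarₐ ℂ)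
  refine ext_of_forall_mem_subalgebra_integral_eq_of_pseudoEMetric_complete_countable
    (𝕜 := ℂ) (A := A) ?_ ?_
  · intro x y hxy
    obtain ⟨f, ⟨g, hg, hgf⟩, hf⟩ := fourierSubalgebra_separatesPoints hxy
    refine ⟨f, ⟨g, ⟨BoundedContinuousFunction.mkOfCompact g, hg, ?_⟩, hgf⟩, hf⟩
    ext; rfl
  · intro g hg
    have hg' : g.toContinuousMap ∈ Submodule.span ℂ (Set.range (fourier (T := T))) := by
      rw [← fourierSubalgebra_coe]; exact hg
    have hint : ∀ (ρ : Measure (AddCircle T)) [IsFiniteMeasure ρ] (f : C(AddCircle T, ℂ)),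
        Integrable (fun x => f x) ρ := fun ρ _ f =>
      (BoundedContinuousFunction.mkOfCompact f).integrable ρ
    change ∫ x, g.toContinuousMap x ∂μ = ∫ x, g.toContinuousMap x ∂ν
    generalize g.toContinuousMap = f at hg'
    induction hg' using Submodule.span_induction with
    | mem f hf => obtain ⟨k, rfl⟩ := hf; exact h k
    | zero => simp
    | add f f' _ _ h1 h2 =>
      simp only [ContinuousMap.add_apply]
      rw [integral_add (hint μ f) (hint μ f'), integral_add (hint ν f) (hint ν f'), h1, h2]
    | smul c f _ h1 =>
      simp only [ContinuousMap.smul_apply]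
      rw [integral_smul, integral_smul, h1]

lemma measurable_coe_circle : Measurable ((↑) : ℝ → AddCircle (2 * Real.pi)) :=
  (AddCircle.continuous_mk' _).measurable

/-- Integer frequencies only see points modulo `2π`, so equality holds after projection to the
circle and not on the line. -/
lemma map_circle_eq {μ ν : Measure ℝ} [IsFiniteMeasure μ] [IsFiniteMeasure ν]
    (h : ∀ k : ℤ, ∫ x : ℝ, Complex.exp (-Complex.I * k * x) ∂μ =
      ∫ x : ℝ, Complex.exp (-Complex.I * k * x) ∂ν) :
    μ.map ((↑) : ℝ → AddCircle (2 * Real.pi)) = ν.map (↑) := by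
  have e : ∀ (ρ : Measure ℝ) (k : ℤ),
      ∫ x, fourier k x ∂(ρ.map ((↑) : ℝ → AddCircle (2 * Real.pi))) =
        ∫ x : ℝ, Complex.exp (-Complex.I * (-k : ℤ) * x) ∂ρ := by
    intro ρ k
    rw [integral_map measurable_coe_circle.aemeasurable
      (fourier k).continuous.aestronglyMeasurable]
    congr 1 with x
    rw [fourier_coe_apply]
    have hpi : (Real.pi : ℂ) ≠ 0 := Complex.ofReal_ne_zero.mpr Real.pi_ne_zero
    congr 1
    push_cast
    field_simp
  have := Measure.isFiniteMeasure_map μ ((↑) : ℝ → AddCircle (2 * Real.pi))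
  have := Measure.isFiniteMeasure_map ν ((↑) : ℝ → AddCircle (2 * Real.pi))
  exact measure_ext_of_integral_fourier fun k => by rw [e, e, h]

lemma map_section_map_circle {μ : Measure ℝ} (hμ : ∀ᵐ x ∂μ, x ∈ Set.Ioc (-Real.pi) Real.pi) :
    (μ.map ((↑) : ℝ → AddCircle (2 * Real.pi))).map
      (fun x => (AddCircle.measurableEquivIoc (2 * Real.pi) (-Real.pi) x : ℝ)) = μ := by
  have hs : Measurable
      fun x => (AddCircle.measurableEquivIoc (2 * Real.pi) (-Real.pi) x : ℝ) :=
    measurable_subtype_coe.comp (AddCircle.measurableEquivIoc _ _).measurable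
  rw [Measure.map_map hs measurable_coe_circle]
  conv_rhs => rw [← Measure.map_id (μ := μ)]
  refine Measure.map_congr ?_
  filter_upwards [hμ] with x hx
  have h : (AddCircle.measurableEquivIoc (2 * Real.pi) (-Real.pi) (x : AddCircle (2 * Real.pi)) : ℝ)
      = toIocMod Real.two_pi_pos (-Real.pi) x := rfl
  rw [Function.comp_apply, h, id, toIocMod_eq_self]
  exact ⟨hx.1, by linarith [hx.2]⟩

/-- A spectral measure of a real autocovariance function is symmetric, provided that it has no
mass at the end points. -/
lemma IsSpectralMeasure.map_neg {R : ℤ → ℝ} {F : Measure ℝ} (hF : IsSpectralMeasure R F)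
    (h1 : F {Real.pi} = 0) (h2 : F {-Real.pi} = 0) : F.map (fun x => -x) = F := by
  have := hF.finite
  have := Measure.isFiniteMeasure_map F fun x : ℝ => -x
  have hae : ∀ᵐ x ∂F, x ∈ Set.Ioo (-Real.pi) Real.pi := by
    have e1 : ∀ᵐ x ∂F, x ≠ Real.pi := by simpa [ae_iff] using h1
    have e2 : ∀ᵐ x ∂F, x ≠ -Real.pi := by simpa [ae_iff] using h2
    filter_upwards [ae_mem_Lam hF.support, e1, e2] with x hx hx1 hx2
    exact ⟨lt_of_le_of_ne hx.1 (Ne.symm hx2), lt_of_le_of_ne hx.2 hx1⟩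
  have hneg : Measurable fun x : ℝ => -x := measurable_neg
  have hcircle : (F.map fun x => -x).map ((↑) : ℝ → AddCircle (2 * Real.pi)) = F.map (↑) := by
    refine map_circle_eq fun k => ?_
    -- Reflection conjugates the exponential, and the Fourier coefficients are real.
    rw [integral_map hneg.aemeasurable (by fun_prop), ← hF.herglotz k, ← Complex.conj_ofReal,
      hF.herglotz k, ← integral_conj]
    congr 1 with x
    rw [← Complex.exp_conj]
    simp
  rw [← map_section_map_circle (μ := F.map fun x => -x), hcircle,
    map_section_map_circle (hae.mono fun x hx => ⟨hx.1, hx.2.le⟩)]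
  refine (ae_map_iff hneg.aemeasurable
    (measurableSet_Ioc : MeasurableSet {x | x ∈ Set.Ioc (-Real.pi) Real.pi})).mpr ?_
  filter_upwards [hae] with x hx
  exact ⟨by linarith [hx.2], by linarith [hx.1]⟩

/-- The spectral measure of noise plus sinusoids. -/
def mixedMeasure {J : ℕ} (R freq : Fin J → ℝ) (FX : Measure ℝ) : Measure ℝ :=
  FX + ∑ j, ENNReal.ofReal (R j ^ 2 / 4) • (Measure.dirac (freq j) + Measure.dirac (-freq j))

instance {J : ℕ} (R freq : Fin J → ℝ) (FX : Measure ℝ) [IsFiniteMeasure FX] :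
    IsFiniteMeasure (mixedMeasure R freq FX) := by
  have : ∀ j, IsFiniteMeasure (ENNReal.ofReal (R j ^ 2 / 4) •
      (Measure.dirac (freq j) + Measure.dirac (-freq j))) := fun j =>
    Measure.smul_finite _ ENNReal.ofReal_ne_top
  unfold mixedMeasure
  infer_instance

lemma integral_mixedMeasure {J : ℕ} (R freq : Fin J → ℝ) (FX : Measure ℝ) [IsFiniteMeasure FX]
    (k : ℤ) :
    ∫ x : ℝ, Complex.exp (-Complex.I * k * x) ∂(mixedMeasure R freq FX) =
      ∫ x : ℝ, Complex.exp (-Complex.I * k * x) ∂FX +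
        ((∑ j, R j ^ 2 / 2 * Real.cos (freq j * k) : ℝ) : ℂ) := by
  have hfin : ∀ j, IsFiniteMeasure (ENNReal.ofReal (R j ^ 2 / 4) •
      (Measure.dirac (freq j) + Measure.dirac (-freq j))) := fun j =>
    Measure.smul_finite _ ENNReal.ofReal_ne_top
  have hi : ∀ (μ : Measure ℝ) [IsFiniteMeasure μ],
      Integrable (fun x : ℝ => Complex.exp (-Complex.I * k * x)) μ := fun μ _ => by
    refine Integrable.of_bound (by fun_prop) 1 (ae_of_all _ fun x => ?_)
    rw [Complex.norm_exp]
    simp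
  rw [mixedMeasure, integral_add_measure (hi _) (hi _), integral_finsetSum_measure
    fun j _ => hi _]
  congr 1
  rw [Complex.ofReal_sum]
  refine Finset.sum_congr rfl fun j _ => ?_
  rw [integral_smul_measure, integral_add_measure (hi _) (hi _), integral_dirac, integral_dirac,
    ENNReal.toReal_ofReal (by positivity)]
  have e : Complex.exp (-Complex.I * k * freq j) + Complex.exp (-Complex.I * k * (-freq j : ℝ)) =
      2 * Complex.cos (freq j * k) := by
    rw [Complex.two_cos, add_comm]
    congr 2 <;> push_cast <;> ring
  rw [e, Complex.real_smul]
  push_cast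
  ring

/-- Noise plus proper sinusoids has no spectral mass at `±π`. -/
lemma spectral_mass_pi_eq_zero {J : ℕ} {R freq : Fin J → ℝ} (hfreq : AreProperFrequencies R freq)
    {RX RY : ℤ → ℝ} {FX FY : Measure ℝ} (hFX : IsSpectralMeasure RX FX)
    (hcont : ∀ x, FX {x} = 0) (hFY : IsSpectralMeasure RY FY)
    (hRY : ∀ h, RY h = RX h + ∑ j, R j ^ 2 / 2 * Real.cos (freq j * h)) :
    FY {Real.pi} = 0 ∧ FY {-Real.pi} = 0 := by
  have := hFX.finite
  have := hFY.finite
  -- The frequencies need not lie in `[-π, π]`, so the two measures are compared only on the circle.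
  have hmap : FY.map ((↑) : ℝ → AddCircle (2 * Real.pi)) =
      (mixedMeasure R freq FX).map (↑) := by
    refine map_circle_eq fun k => ?_
    rw [integral_mixedMeasure, ← hFX.herglotz, ← hFY.herglotz, hRY]
    push_cast; rfl
  -- The odd multiples of `π`: a countable set, null for the noise, that avoids every active
  -- frequency and its negative.
  set S : Set ℝ := (fun x : ℝ => (x : AddCircle (2 * Real.pi))) ⁻¹' {(Real.pi : AddCircle _)}
    with hS
  have hmem : ∀ x : ℝ, x ∈ S ↔ ∃ k : ℤ, x = Real.pi + k * (2 * Real.pi) := fun x => by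
    rw [hS, Set.mem_preimage, Set.mem_singleton_iff, ← sub_eq_zero, ← AddCircle.coe_sub,
      AddCircle.coe_eq_zero_iff]
    refine exists_congr fun k => ?_
    rw [zsmul_eq_mul]
    constructor <;> intro h <;> linarith
  have hSm : MeasurableSet S := measurable_coe_circle (measurableSet_singleton _)
  have hSc : S.Countable := by
    refine (Set.countable_range fun k : ℤ => Real.pi + k * (2 * Real.pi)).mono fun x hx => ?_
    obtain ⟨k, hk⟩ := (hmem x).mp hx
    exact ⟨k, hk.symm⟩
  have h0 : mixedMeasure R freq FX S = 0 := by
    have hX0 : FX S = 0 := by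
      have : NullSingletonClass FX := ⟨hcont⟩
      exact hSc.measure_zero FX
    rw [mixedMeasure, Measure.add_apply, hX0, zero_add, Measure.finsetSum_apply]
    refine Finset.sum_eq_zero fun j _ => ?_
    rw [Measure.smul_apply, Measure.add_apply, Measure.dirac_apply' _ hSm,
      Measure.dirac_apply' _ hSm]
    by_cases hj : R j = 0
    · simp [hj]
    · have hne := hfreq.ne_int_mul_pi j hj
      have e1 : freq j ∉ S := fun h => by
        obtain ⟨k, hk⟩ := (hmem _).mp h
        exact hne (1 + 2 * k) (by rw [hk]; push_cast; ring)
      have e2 : -freq j ∉ S := fun h => by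
        obtain ⟨k, hk⟩ := (hmem _).mp h
        exact hne (-(1 + 2 * k)) (by rw [← neg_neg (freq j), hk]; push_cast; ring)
      simp [e1, e2]
  have hY0 : FY S = 0 := by
    rw [← h0, hS, ← Measure.map_apply measurable_coe_circle (measurableSet_singleton _), hmap,
      Measure.map_apply measurable_coe_circle (measurableSet_singleton _)]
  exact ⟨measure_mono_null (Set.singleton_subset_iff.mpr ((hmem _).mpr ⟨0, by simp⟩)) hY0,
    measure_mono_null (Set.singleton_subset_iff.mpr ((hmem _).mpr ⟨-1, by push_cast; ring⟩)) hY0⟩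

/-! ### The limit objective as a series over lags -/

lemma IsSpectralMeasure.eq_integral_cos {R : ℤ → ℝ} {F : Measure ℝ} (hF : IsSpectralMeasure R F)
    (h : ℤ) : R h = ∫ x, Real.cos (h * x) ∂F := by
  have := hF.finite
  have hi : Integrable (fun x : ℝ => Complex.exp (-Complex.I * h * x)) F := by
    refine Integrable.of_bound (by fun_prop) 1 (ae_of_all _ fun x => ?_)
    rw [Complex.norm_exp]
    simp
  have e := congrArg Complex.re (hF.herglotz h)
  rw [Complex.ofReal_re] at e
  rw [e]
  have e2 := integral_re hi
  rw [RCLike.re_eq_complex_re] at e2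
  rw [← e2]
  congr 1 with x
  have : -Complex.I * h * x = ((-(h * x) : ℝ) : ℂ) * Complex.I := by push_cast; ring
  rw [this, Complex.exp_ofReal_mul_I_re, Real.cos_neg]

/-- Writing `R(h)` as a cosine integral and exchanging sum and integral reduces this to the
pointwise cosine series; symmetry of `F` then merges `|w + θ|` with `|w - θ|`. -/
lemma hasSum_autocov_mul_checkCoeff {R : ℤ → ℝ} {F : Measure ℝ} (hF : IsSpectralMeasure R F)
    (h1 : F {Real.pi} = 0) (h2 : F {-Real.pi} = 0) {p θ : ℝ} (hp : p ∈ Set.Icc (0 : ℝ) 1)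
    (hθ : θ ∈ Lam) :
    HasSum (fun h : ℤ => R h * checkCoeff p h θ) (Real.pi * limitObjective F p θ) := by
  have := hF.finite
  have hic : ∀ {g : ℝ → ℝ}, Continuous g → Integrable g F := fun hg =>
    integrable_of_continuous_of_support hF.support hg
  have hs := hasSum_integral_of_summable_integral_norm (μ := F)
    (F := fun (n : ℤ) w => checkCoeff p n θ * Real.cos (n * w))
    (fun n => hic (by fun_prop)) ?_
  · convert! hs using 1
    · ext n
      rw [integral_const_mul, hF.eq_integral_cos, mul_comm]
    · have e : ∫ w, ∑' n : ℤ, checkCoeff p n θ * Real.cos (n * w) ∂F =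
          ∫ w, Real.pi * θ * (1 - 2 * p) + Real.pi / 2 * (|w - θ| + |w + θ|) ∂F := by
        refine integral_congr_ae ?_
        filter_upwards [ae_mem_Lam hF.support] with w hw
        exact (hasSum_checkCoeff_mul_cos hθ hw).tsum_eq
      have hsym : ∫ w, |w + θ| ∂F = ∫ w, |w - θ| ∂F := by
        conv_rhs => rw [← hF.map_neg h1 h2]
        rw [integral_map (by fun_prop) (by fun_prop)]
        congr 1 with w
        rw [← abs_neg]; ring_nf
      rw [e, integral_add (integrable_const _) (hic (by fun_prop)),
        integral_const_mul (Real.pi / 2), integral_add (hic (by fun_prop)) (hic (by fun_prop)), hsym,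
        limitObjective, integral_add (hic (by fun_prop)) (integrable_const _)]
      simp
      ring
  · refine Summable.of_nonneg_of_le (fun n => integral_nonneg fun w => norm_nonneg _)
      (fun n => ?_) (summable_checkWeight.mul_right (F.real Set.univ))
    have : ∫ w, ‖checkCoeff p n θ * Real.cos (n * w)‖ ∂F ≤ ∫ w, checkWeight n ∂F := by
      refine integral_mono (hic (by fun_prop)) (integrable_const _) fun w => ?_
      simp only [norm_mul, Real.norm_eq_abs]
      exact (mul_le_of_le_one_right (abs_nonneg _) (Real.abs_cos_le_one _)).trans
        (abs_checkCoeff_le hp hθ n)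
    simpa [mul_comm] using this

/-! ### Averages of exponentials and Wiener's theorem -/

lemma norm_sum_pow_le {z : ℂ} (hz : ‖z‖ = 1) (hz1 : z ≠ 1) (N : ℕ) :
    ‖∑ s ∈ Finset.Icc 1 N, z ^ s‖ ≤ 2 / ‖z - 1‖ := by
  have e : Finset.Icc 1 N = Finset.Ico 1 (N + 1) := rfl
  rw [e, geom_sum_Ico hz1 (by omega), norm_div]
  gcongr
  calc ‖z ^ (N + 1) - z ^ 1‖ ≤ ‖z ^ (N + 1)‖ + ‖z ^ 1‖ := norm_sub_le _ _
    _ = 2 := by rw [norm_pow, norm_pow, hz]; norm_num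

lemma tendsto_average_pow {z : ℂ} (hz : ‖z‖ = 1) (hz1 : z ≠ 1) :
    Tendsto (fun N : ℕ => (N : ℂ)⁻¹ * ∑ s ∈ Finset.Icc 1 N, z ^ s) atTop (𝓝 0) := by
  refine squeeze_zero_norm (a := fun N : ℕ => (2 / ‖z - 1‖) / N) (fun N => ?_)
    (tendsto_const_div_atTop_nhds_zero_nat _)
  rw [norm_mul, norm_inv, Complex.norm_natCast, div_eq_mul_inv _ (N : ℝ), mul_comm]
  gcongr
  exact norm_sum_pow_le hz hz1 N

lemma norm_average_pow_le {z : ℂ} (hz : ‖z‖ = 1) (N : ℕ) :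
    ‖(N : ℂ)⁻¹ * ∑ s ∈ Finset.Icc 1 N, z ^ s‖ ≤ 1 := by
  rw [norm_mul, norm_inv, Complex.norm_natCast]
  have : ‖∑ s ∈ Finset.Icc 1 N, z ^ s‖ ≤ N := by
    refine (norm_sum_le _ _).trans ?_
    simp [hz]
  calc (N : ℝ)⁻¹ * ‖∑ s ∈ Finset.Icc 1 N, z ^ s‖ ≤ (N : ℝ)⁻¹ * N := by gcongr
    _ ≤ 1 := by rw [mul_comm]; exact mul_inv_le_one

lemma exp_mul_I_eq_one_iff (x : ℝ) :
    Complex.exp (x * Complex.I) = 1 ↔ ∃ k : ℤ, x = k * (2 * Real.pi) := by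
  rw [Complex.exp_eq_one_iff]
  refine exists_congr fun k => ?_
  rw [← mul_assoc, mul_left_inj' Complex.I_ne_zero]
  exact_mod_cast Iff.rfl

/-- Averages of `cos (μ s + c)` are bounded, uniformly in the phase `c`, by those of
`e^{iμs}`. -/
lemma abs_average_cos_le (μ c : ℝ) (N : ℕ) :
    |(N : ℝ)⁻¹ * ∑ s ∈ Finset.Icc 1 N, Real.cos (μ * s + c)| ≤
      ‖(N : ℂ)⁻¹ * ∑ s ∈ Finset.Icc 1 N, Complex.exp (μ * Complex.I) ^ s‖ := by
  have e : (N : ℝ)⁻¹ * ∑ s ∈ Finset.Icc 1 N, Real.cos (μ * s + c) =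
      (Complex.exp (c * Complex.I) *
        ((N : ℂ)⁻¹ * ∑ s ∈ Finset.Icc 1 N, Complex.exp (μ * Complex.I) ^ s)).re := by
    rw [mul_left_comm, Finset.mul_sum (a := Complex.exp (c * Complex.I))]
    have : ∀ s ∈ Finset.Icc 1 N, Complex.exp (c * Complex.I) * Complex.exp (μ * Complex.I) ^ s =
        Complex.exp (((μ * s + c : ℝ) : ℂ) * Complex.I) := fun s _ => by
      rw [← Complex.exp_nat_mul, ← Complex.exp_add]
      congr 1; push_cast; ring
    rw [Finset.sum_congr rfl this, ← Complex.ofReal_natCast, ← Complex.ofReal_inv,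
      Complex.re_ofReal_mul, Complex.re_sum]
    simp_rw [Complex.exp_ofReal_mul_I_re]
  rw [e]
  refine (Complex.abs_re_le_norm _).trans ?_
  rw [norm_mul, Complex.norm_exp_ofReal_mul_I, one_mul]

lemma IsSpectralMeasure.even {R : ℤ → ℝ} {F : Measure ℝ} (hF : IsSpectralMeasure R F) (h : ℤ) :
    R (-h) = R h := by
  rw [hF.eq_integral_cos, hF.eq_integral_cos]
  simp

/-- Since `R` is even, `R(h)²` is `R(h) R(-h)`, the Fourier transform of the difference of two
independent copies. -/
lemma IsSpectralMeasure.integral_prod {R : ℤ → ℝ} {F : Measure ℝ} (hF : IsSpectralMeasure R F)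
    (h : ℤ) :
    ((R h : ℂ)) ^ 2 = ∫ q : ℝ × ℝ, Complex.exp (((-(h * (q.1 - q.2)) : ℝ) : ℂ) * Complex.I)
      ∂(F.prod F) := by
  have := hF.finite
  have e := integral_prod_mul (μ := F) (ν := F) (fun x : ℝ => Complex.exp (-Complex.I * h * x))
    (fun x : ℝ => Complex.exp (-Complex.I * (-h : ℤ) * x))
  rw [← hF.herglotz, ← hF.herglotz, hF.even, ← sq] at e
  rw [← e]
  congr 1 with q
  rw [← Complex.exp_add]
  congr 1
  push_cast; ring

/-- The diagonal modulo `2π` has countable sections, which are null for an atomless measure; by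
Fubini it is null for the product. -/
lemma ae_exp_sub_ne_one {F : Measure ℝ} [IsFiniteMeasure F] (hF : ∀ x, F {x} = 0) :
    ∀ᵐ q : ℝ × ℝ ∂(F.prod F),
      Complex.exp (((-(q.1 - q.2) : ℝ) : ℂ) * Complex.I) ≠ 1 := by
  have : NullSingletonClass F := ⟨hF⟩
  rw [ae_iff]
  simp only [not_not]
  have hm : MeasurableSet {q : ℝ × ℝ |
      Complex.exp (((-(q.1 - q.2) : ℝ) : ℂ) * Complex.I) = 1} :=
    measurableSet_eq_fun (by fun_prop) measurable_const
  rw [Measure.measure_prod_null hm]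
  refine ae_of_all _ fun x => ?_
  refine Set.Countable.measure_zero ?_ F
  refine (Set.countable_range fun k : ℤ => x + k * (2 * Real.pi)).mono fun y hy => ?_
  obtain ⟨k, hk⟩ := (exp_mul_I_eq_one_iff _).mp hy
  exact ⟨k, by linarith⟩

/-- **Wiener's theorem** for a spectral measure without atoms. -/
lemma tendsto_average_sq {R : ℤ → ℝ} {F : Measure ℝ} (hF : IsSpectralMeasure R F)
    (hcont : ∀ x, F {x} = 0) (k : ℤ) :
    Tendsto (fun N : ℕ => ((N : ℝ)⁻¹) ^ 2 * ∑ s ∈ Finset.Icc 1 N, ∑ t ∈ Finset.Icc 1 N,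
      R ((s : ℤ) - t + k) ^ 2) atTop (𝓝 0) := by
  have := hF.finite
  let ζ : ℝ × ℝ → ℂ := fun q => Complex.exp (((-(q.1 - q.2) : ℝ) : ℂ) * Complex.I)
  have hζ : ∀ q, ‖ζ q‖ = 1 := fun q => Complex.norm_exp_ofReal_mul_I _
  have hζi : ∀ q, ‖(ζ q)⁻¹‖ = 1 := fun q => by rw [norm_inv, hζ, inv_one]
  have hζ0 : ∀ q, ζ q ≠ 0 := fun q => Complex.exp_ne_zero _
  -- The double average factors into two geometric averages, each bounded by one and tending to zero
  -- off the diagonal, so dominated convergence applies.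
  let g : ℕ → ℝ × ℝ → ℂ := fun N q => ζ q ^ k *
    (((N : ℂ)⁻¹ * ∑ s ∈ Finset.Icc 1 N, ζ q ^ s) *
      ((N : ℂ)⁻¹ * ∑ s ∈ Finset.Icc 1 N, (ζ q)⁻¹ ^ s))
  have hpow : ∀ (h : ℤ) q, ζ q ^ h =
      Complex.exp (((-(h * (q.1 - q.2)) : ℝ) : ℂ) * Complex.I) := fun h q => by
    rw [← Complex.exp_int_mul]; congr 1; push_cast; ring
  have hint : ∀ h : ℤ, Integrable (fun q => ζ q ^ h) (F.prod F) := fun h => by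
    simp_rw [hpow]
    refine Integrable.of_bound (by fun_prop) 1 (ae_of_all _ fun q => ?_)
    rw [Complex.norm_exp_ofReal_mul_I]
  have hg : ∀ N q, g N q = ((N : ℂ)⁻¹) ^ 2 * ∑ s ∈ Finset.Icc 1 N, ∑ t ∈ Finset.Icc 1 N,
      ζ q ^ ((s : ℤ) - t + k) := fun N q => by
    have : ∑ s ∈ Finset.Icc 1 N, ∑ t ∈ Finset.Icc 1 N, ζ q ^ ((s : ℤ) - t + k) =
        ζ q ^ k * ((∑ s ∈ Finset.Icc 1 N, ζ q ^ s) * ∑ s ∈ Finset.Icc 1 N, (ζ q)⁻¹ ^ s) := by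
      rw [Finset.sum_mul_sum, Finset.mul_sum]
      refine Finset.sum_congr rfl fun s _ => ?_
      rw [Finset.mul_sum]
      refine Finset.sum_congr rfl fun t _ => ?_
      rw [zpow_add₀ (hζ0 q), zpow_sub₀ (hζ0 q), zpow_natCast, zpow_natCast, inv_pow]
      ring
    rw [this]
    simp only [g]
    ring
  have key : ∀ N : ℕ, ((((N : ℝ)⁻¹) ^ 2 * ∑ s ∈ Finset.Icc 1 N, ∑ t ∈ Finset.Icc 1 N,
      R ((s : ℤ) - t + k) ^ 2 : ℝ) : ℂ) = ∫ q, g N q ∂(F.prod F) := fun N => by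
    simp_rw [hg]
    rw [integral_const_mul, integral_finsetSum _ fun s _ => integrable_finsetSum _
      fun t _ => hint _]
    push_cast
    congr 1
    refine Finset.sum_congr rfl fun s _ => ?_
    rw [integral_finsetSum _ fun t _ => hint _]
    refine Finset.sum_congr rfl fun t _ => ?_
    rw [hF.integral_prod]
    simp_rw [hpow]
  have hlim : Tendsto (fun N => ∫ q, g N q ∂(F.prod F)) atTop (𝓝 (∫ _q, (0 : ℂ) ∂(F.prod F))) := by
    refine tendsto_integral_of_dominated_convergence (fun _ => (1 : ℝ)) (fun N => ?_)
      (integrable_const _) (fun N => ae_of_all _ fun q => ?_) ?_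
    · rw [funext (hg N)]
      exact (Integrable.const_mul (integrable_finsetSum _ fun s _ => integrable_finsetSum _
        fun t _ => hint _) _).aestronglyMeasurable
    · simp only [g]
      rw [norm_mul, norm_mul, norm_zpow, hζ, one_zpow, one_mul]
      exact mul_le_one₀ (norm_average_pow_le (hζ q) N) (norm_nonneg _)
        (norm_average_pow_le (hζi q) N)
    · filter_upwards [ae_exp_sub_ne_one hcont] with q hq
      have h1 := tendsto_average_pow (hζ q) hq
      have h2 := tendsto_average_pow (hζi q) (inv_ne_one.mpr hq)
      have h3 := (h1.mul h2).const_mul (ζ q ^ k)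
      rwa [mul_zero, mul_zero] at h3
  rw [integral_zero] at hlim
  simp_rw [← key] at hlim
  have hre := (Complex.continuous_re.tendsto _).comp hlim
  simp only [Function.comp_def, Complex.ofReal_re, Complex.zero_re] at hre
  exact hre

/-- Cauchy–Schwarz on the `N²` pairs reduces this to the average of squares. -/
lemma tendsto_average_abs {R : ℤ → ℝ} {F : Measure ℝ} (hF : IsSpectralMeasure R F)
    (hcont : ∀ x, F {x} = 0) :
    Tendsto (fun N : ℕ => ((N : ℝ)⁻¹) ^ 2 * ∑ s ∈ Finset.Icc 1 N, ∑ t ∈ Finset.Icc 1 N,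
      |R ((s : ℤ) - t)|) atTop (𝓝 0) := by
  have h := (tendsto_average_sq hF hcont 0).sqrt
  rw [Real.sqrt_zero] at h
  refine squeeze_zero (fun N => by positivity) (fun N => ?_) h
  refine Real.le_sqrt_of_sq_le ?_
  have e : ∀ f : ℤ → ℝ, ∑ s ∈ Finset.Icc 1 N, ∑ t ∈ Finset.Icc 1 N, f ((s : ℤ) - t) =
      ∑ q ∈ Finset.Icc 1 N ×ˢ Finset.Icc 1 N, f ((q.1 : ℤ) - q.2) := fun f =>
    (Finset.sum_product' _ _ fun s t : ℕ => f ((s : ℤ) - t)).symm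
  have hcs := sq_sum_le_card_mul_sum_sq (s := Finset.Icc 1 N ×ˢ Finset.Icc 1 N)
    (f := fun q => |R ((q.1 : ℤ) - q.2)|)
  simp_rw [sq_abs] at hcs
  rw [Finset.card_product, Nat.card_Icc] at hcs
  simp only [add_zero]
  rw [e (fun d => |R d|), e (fun d => R d ^ 2), mul_pow]
  rcases Nat.eq_zero_or_pos N with rfl | hN
  · simp
  · have hN' : (N : ℝ) ≠ 0 := by positivity
    calc _ ≤ (((N : ℝ)⁻¹) ^ 2) ^ 2 * (((N + 1 - 1) * (N + 1 - 1) : ℕ) *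
          ∑ q ∈ Finset.Icc 1 N ×ˢ Finset.Icc 1 N, R ((q.1 : ℤ) - q.2) ^ 2) := by gcongr
      _ = _ := by
        rw [Nat.add_sub_cancel]; push_cast; field_simp

/-! ### Convergence in mean and the noise -/

section Proc

variable {Ω : Type*} [MeasurableSpace Ω] {P : Measure Ω}

/-- A sequence of random variables that converges to zero in mean. -/
structure IsL1Null (P : Measure Ω) (f : ℕ → Ω → ℝ) : Prop where
  measurable : ∀ N, Measurable (f N)
  tendsto : Tendsto (fun N => ∫⁻ ω, ‖f N ω‖ₑ ∂P) atTop (𝓝 0)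

lemma IsL1Null.of_le {f g : ℕ → Ω → ℝ} (hf : IsL1Null P f) (hg : ∀ N, Measurable (g N))
    (h : ∀ᶠ N in atTop, ∀ ω, |g N ω| ≤ |f N ω|) : IsL1Null P g := by
  refine ⟨hg, tendsto_of_tendsto_of_tendsto_of_le_of_le' tendsto_const_nhds hf.tendsto
    (Eventually.of_forall fun N => bot_le) ?_⟩
  filter_upwards [h] with N hN
  refine lintegral_mono fun ω => ?_
  simpa [Real.enorm_eq_ofReal_abs] using ENNReal.ofReal_le_ofReal (hN ω)

lemma IsL1Null.add {f g : ℕ → Ω → ℝ} (hf : IsL1Null P f) (hg : IsL1Null P g) :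
    IsL1Null P fun N ω => f N ω + g N ω := by
  refine ⟨fun N => (hf.measurable N).add (hg.measurable N), ?_⟩
  have h := hf.tendsto.add hg.tendsto
  rw [add_zero] at h
  refine tendsto_of_tendsto_of_tendsto_of_le_of_le tendsto_const_nhds h (fun N => bot_le)
    fun N => ?_
  simp only
  rw [← lintegral_add_left (hf.measurable N).enorm]
  exact lintegral_mono fun ω => enorm_add_le _ _

lemma IsL1Null.zero : IsL1Null P fun _ _ => 0 :=
  ⟨fun _ => measurable_const, by simp⟩

lemma IsL1Null.sum {ι : Type*} (s : Finset ι) {f : ι → ℕ → Ω → ℝ}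
    (hf : ∀ i ∈ s, IsL1Null P (f i)) : IsL1Null P fun N ω => ∑ i ∈ s, f i N ω := by
  classical
  induction s using Finset.induction_on with
  | empty => simpa using IsL1Null.zero
  | insert i s hi ih =>
    simp_rw [Finset.sum_insert hi]
    exact (hf i (Finset.mem_insert_self _ _)).add
      (ih fun j hj => hf j (Finset.mem_insert_of_mem hj))

lemma IsL1Null.const_mul {f : ℕ → Ω → ℝ} (hf : IsL1Null P f) (c : ℝ) :
    IsL1Null P fun N ω => c * f N ω := by
  refine ⟨fun N => (hf.measurable N).const_mul c, ?_⟩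
  have h := ENNReal.Tendsto.const_mul hf.tendsto (a := ‖c‖ₑ) (Or.inr enorm_ne_top)
  rw [mul_zero] at h
  refine h.congr fun N => ?_
  simp_rw [enorm_mul]
  rw [lintegral_const_mul _ (hf.measurable N).enorm]

lemma IsL1Null.mul_of_abs_le_one {f : ℕ → Ω → ℝ} (hf : IsL1Null P f) {g : Ω → ℝ}
    (hg : Measurable g) (h : ∀ ω, |g ω| ≤ 1) : IsL1Null P fun N ω => g ω * f N ω :=
  hf.of_le (fun N => hg.mul (hf.measurable N)) <| Eventually.of_forall fun N ω => by
    rw [abs_mul]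
    exact mul_le_of_le_one_left (abs_nonneg _) (h ω)

lemma IsL1Null.of_deterministic [IsProbabilityMeasure P] {f : ℕ → Ω → ℝ}
    (hf : ∀ N, Measurable (f N)) {u : ℕ → ℝ} (hu : Tendsto u atTop (𝓝 0))
    (h : ∀ᶠ N in atTop, ∀ ω, |f N ω| ≤ u N) : IsL1Null P f := by
  have hu' : IsL1Null P fun N _ => u N := by
    refine ⟨fun N => measurable_const, ?_⟩
    have := (continuous_enorm.tendsto (0 : ℝ)).comp hu
    simpa [Function.comp_def] using this
  refine hu'.of_le hf ?_
  filter_upwards [h] with N hN ω using (hN ω).trans (le_abs_self _)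

lemma integral_abs_le_sqrt [IsProbabilityMeasure P] {f : Ω → ℝ} (hf : MemLp f 2 P) :
    ∫ ω, |f ω| ∂P ≤ √(∫ ω, f ω ^ 2 ∂P) := by
  refine Real.le_sqrt_of_sq_le ?_
  have h := variance_nonneg (fun ω => |f ω|) P
  rw [variance_eq_sub (X := fun ω => |f ω|) hf.abs] at h
  have e : P[(fun ω => |f ω|) ^ 2] = ∫ ω, f ω ^ 2 ∂P := by simp
  rw [e] at h
  linarith

lemma IsL1Null.of_sq [IsProbabilityMeasure P] {f : ℕ → Ω → ℝ} (hm : ∀ N, Measurable (f N))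
    (hf : ∀ N, MemLp (f N) 2 P) {u : ℕ → ℝ} (hu : Tendsto u atTop (𝓝 0))
    (h : ∀ᶠ N in atTop, ∫ ω, f N ω ^ 2 ∂P ≤ u N) : IsL1Null P f := by
  refine ⟨hm, ?_⟩
  have e : ∀ N, ∫⁻ ω, ‖f N ω‖ₑ ∂P = ENNReal.ofReal (∫ ω, |f N ω| ∂P) := fun N => by
    rw [ofReal_integral_eq_lintegral_ofReal ((hf N).integrable one_le_two).abs
      (ae_of_all _ fun ω => abs_nonneg _)]
    simp_rw [Real.enorm_eq_ofReal_abs]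
  simp_rw [e]
  have h2 : Tendsto (fun N => ENNReal.ofReal (√(u N))) atTop (𝓝 0) := by
    have := ENNReal.tendsto_ofReal hu.sqrt
    simpa using this
  refine tendsto_of_tendsto_of_tendsto_of_le_of_le' tendsto_const_nhds h2
    (Eventually.of_forall fun N => bot_le) ?_
  filter_upwards [h] with N hN
  exact ENNReal.ofReal_le_ofReal ((integral_abs_le_sqrt (hf N)).trans (Real.sqrt_le_sqrt hN))

variable {X : ℤ → Ω → ℝ}

lemma IsSecondOrderStationary.covariance_eq (hX : IsSecondOrderStationary P X) (s t : ℤ) :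
    covariance (X s) (X t) P = autocov P X (s - t) := by
  have := hX.cov_shift t (s - t)
  rwa [add_sub_cancel] at this

lemma IsSecondOrderStationary.integral_mul [IsProbabilityMeasure P]
    (hX : IsSecondOrderStationary P X) (s t : ℤ) :
    ∫ ω, X s ω * X t ω ∂P = autocov P X (s - t) := by
  rw [← hX.covariance_eq, covariance_eq_sub (hX.memLp_two s) (hX.memLp_two t), hX.mean_zero]
  simp

/-- Weighted averages of the noise converge to zero in mean. -/
lemma isL1Null_weighted_average [IsProbabilityMeasure P] (hX : IsSecondOrderStationary P X)
    {FX : Measure ℝ} (hFX : IsSpectralMeasure (autocov P X) FX) (hcont : ∀ x, FX {x} = 0)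
    {a : ℕ → ℝ} (ha : ∀ s, |a s| ≤ 1) (k : ℤ) :
    IsL1Null P fun N ω => (N : ℝ)⁻¹ * ∑ s ∈ Finset.Icc 1 N, a s * X (s + k) ω := by
  have hL : ∀ N : ℕ, MemLp (fun ω => (N : ℝ)⁻¹ * ∑ s ∈ Finset.Icc 1 N, a s * X (s + k) ω) 2 P :=
    fun N => (memLp_finsetSum _ fun (s : ℕ) _ =>
      (hX.memLp_two (s + k)).const_mul (a s)).const_mul _
  refine IsL1Null.of_sq (fun N => ?_) hL (tendsto_average_abs hFX hcont)
    (Eventually.of_forall fun N => ?_)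
  · exact (Finset.measurable_fun_sum _ fun s _ => (hX.measurable _).const_mul _).const_mul _
  -- Weights of modulus at most one bound the second moment by the average of `|R(s - t)|`.
  · have e : ∀ ω, ((N : ℝ)⁻¹ * ∑ s ∈ Finset.Icc 1 N, a s * X (s + k) ω) ^ 2 =
        ((N : ℝ)⁻¹) ^ 2 * ∑ s ∈ Finset.Icc 1 N, ∑ t ∈ Finset.Icc 1 N,
          a s * a t * (X (s + k) ω * X (t + k) ω) := fun ω => by
      rw [mul_pow, sq (∑ s ∈ Finset.Icc 1 N, a s * X (s + k) ω), Finset.sum_mul_sum]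
      congr 1
      exact Finset.sum_congr rfl fun s _ => Finset.sum_congr rfl fun t _ => by ring
    have hi : ∀ s t : ℕ, Integrable (fun ω => a s * a t * (X (s + k) ω * X (t + k) ω)) P :=
      fun s t => ((hX.memLp_two _).integrable_mul (hX.memLp_two _)).const_mul _
    simp_rw [e]
    rw [integral_const_mul, integral_finsetSum _ fun s _ => integrable_finsetSum _
      fun t _ => hi s t]
    gcongr with s _
    rw [integral_finsetSum _ fun t _ => hi s t]
    gcongr with t _
    rw [integral_const_mul, hX.integral_mul, add_sub_add_right_eq_sub]
    refine (le_abs_self _).trans ?_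
    rw [abs_mul, abs_mul]
    exact mul_le_of_le_one_left (abs_nonneg _) (mul_le_one₀ (ha s) (abs_nonneg _) (ha t))

lemma HasSummableFourthCumulants.memLp_mul (hX4 : HasSummableFourthCumulants P X) (s t : ℤ) :
    MemLp (fun ω => X s ω * X t ω) 2 P := by
  have : ENNReal.HolderTriple 4 4 2 := ⟨by
    rw [← two_mul, show (4 : ENNReal) = 2 * 2 by norm_num, ENNReal.mul_inv (by simp) (by simp),
      ← mul_assoc, ENNReal.mul_inv_cancel (by simp) (by simp), one_mul]⟩
  exact (hX4.memLp_four t).mul (hX4.memLp_four s)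

/-- Fourth moments through cumulants. -/
lemma covariance_products [IsProbabilityMeasure P] (hX : IsSecondOrderStationary P X)
    (hX4 : HasSummableFourthCumulants P X) (h : ℤ) (s t : ℤ) :
    ∫ ω, (X s ω * X (s + h) ω - autocov P X (-h)) * (X t ω * X (t + h) ω - autocov P X (-h)) ∂P =
      cum4 P (X 0) (X h) (X (t - s)) (X (t - s + h)) +
        autocov P X (s - t) ^ 2 + autocov P X (s - t - h) * autocov P X (s - t + h) := by
  set r := autocov P X (-h) with hr
  have hi : ∀ s t : ℤ, Integrable (fun ω => X s ω * X t ω) P := fun s t =>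
    (hX.memLp_two s).integrable_mul (hX.memLp_two t)
  have hi4 : Integrable (fun ω => (X s ω * X (s + h) ω) * (X t ω * X (t + h) ω)) P :=
    (hX4.memLp_mul s (s + h)).integrable_mul (hX4.memLp_mul t (t + h))
  have e : ∀ ω, (X s ω * X (s + h) ω - r) * (X t ω * X (t + h) ω - r) =
      (X s ω * X (s + h) ω) * (X t ω * X (t + h) ω) - r * (X s ω * X (s + h) ω) -
        r * (X t ω * X (t + h) ω) + r ^ 2 := fun ω => by ring
  simp_rw [e]
  have i1 : Integrable (fun ω => (X s ω * X (s + h) ω) * (X t ω * X (t + h) ω) -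
      r * (X s ω * X (s + h) ω)) P := hi4.sub ((hi _ _).const_mul _)
  have i2 : Integrable (fun ω => (X s ω * X (s + h) ω) * (X t ω * X (t + h) ω) -
      r * (X s ω * X (s + h) ω) - r * (X t ω * X (t + h) ω)) P := i1.sub ((hi _ _).const_mul _)
  rw [integral_add i2 (integrable_const _), integral_sub i1 ((hi _ _).const_mul _),
    integral_sub hi4 ((hi _ _).const_mul _), integral_const_mul, integral_const_mul,
    hX.integral_mul, hX.integral_mul]
  have hc := hX4.cum_shift s h (t - s) (t - s + h)
  rw [show s + (t - s) = t by ring, show s + (t - s + h) = t + h by ring] at hc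
  rw [← hc, cum4]
  simp only [hX.mean_zero, sub_zero, hX.covariance_eq]
  simp only [← mul_assoc, sub_add_cancel_left, integral_const, probReal_univ, one_smul,
    add_sub_add_right_eq_sub, ← hr]
  rw [show s - (t + h) = s - t - h by ring, show s + h - t = s - t + h by ring]
  ring

/-- For fixed `s` the index triples are distinct as `t` varies, so each inner sum is at most the
total; the bound grows like `N`, not `N²`. -/
lemma sum_sum_abs_cum4_le (hX4 : HasSummableFourthCumulants P X) (h : ℤ) (N : ℕ) :
    ∑ s ∈ Finset.Icc 1 N, ∑ t ∈ Finset.Icc 1 N,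
      |cum4 P (X 0) (X h) (X ((t : ℤ) - s)) (X ((t : ℤ) - s + h))| ≤
      N * ∑' u : ℤ × ℤ × ℤ, |cum4 P (X 0) (X u.1) (X u.2.1) (X u.2.2)| := by
  have : ∀ s ∈ Finset.Icc 1 N, ∑ t ∈ Finset.Icc 1 N,
      |cum4 P (X 0) (X h) (X ((t : ℤ) - s)) (X ((t : ℤ) - s + h))| ≤
      ∑' u : ℤ × ℤ × ℤ, |cum4 P (X 0) (X u.1) (X u.2.1) (X u.2.2)| := fun s _ => by
    have hinj : Function.Injective fun t : ℕ => ((h, (t : ℤ) - s, (t : ℤ) - s + h) : ℤ × ℤ × ℤ) :=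
      fun a b hab => by
        simp only [Prod.mk.injEq] at hab
        omega
    have := hX4.summable_cum.sum_le_tsum (Finset.map ⟨_, hinj⟩ (Finset.Icc 1 N))
      fun u _ => abs_nonneg _
    rwa [Finset.sum_map] at this
  refine (Finset.sum_le_sum this).trans ?_
  simp

/-- Sample autocovariances of the noise are consistent in mean. -/
lemma isL1Null_noise_autocov [IsProbabilityMeasure P] (hX : IsSecondOrderStationary P X)
    (hX4 : HasSummableFourthCumulants P X)
    {FX : Measure ℝ} (hFX : IsSpectralMeasure (autocov P X) FX) (hcont : ∀ x, FX {x} = 0)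
    (h : ℤ) :
    IsL1Null P fun N ω => (N : ℝ)⁻¹ * ∑ s ∈ Finset.Icc 1 N, X s ω * X (s + h) ω -
      autocov P X h := by
  set r := autocov P X (-h) with hr
  have hrr : autocov P X h = r := (hFX.even h).symm
  set K := ∑' u : ℤ × ℤ × ℤ, |cum4 P (X 0) (X u.1) (X u.2.1) (X u.2.2)|
  have hmp : ∀ s : ℕ, MemLp (fun ω => X s ω * X (s + h) ω - r) 2 P := fun s =>
    (hX4.memLp_mul s (s + h)).sub (memLp_const r)
  have hmain : IsL1Null P fun N ω => (N : ℝ)⁻¹ *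
      ∑ s ∈ Finset.Icc 1 N, (X s ω * X (s + h) ω - r) := by
    let A : ℤ → ℕ → ℝ := fun k N => ((N : ℝ)⁻¹) ^ 2 * ∑ s ∈ Finset.Icc 1 N,
      ∑ t ∈ Finset.Icc 1 N, autocov P X ((s : ℤ) - t + k) ^ 2
    have hA : ∀ k, Tendsto (A k) atTop (𝓝 0) := fun k => tendsto_average_sq hFX hcont k
    -- The variance splits into cumulants, of order `1 / N`, and Wiener averages at shifts `0` and
    -- `±h`; the mixed product of autocovariances is split by `2ab ≤ a² + b²`.
    have hu : Tendsto (fun N : ℕ => K / N + A 0 N + (1 / 2 * A (-h) N + 1 / 2 * A h N)) atTop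
        (𝓝 0) := by
      have := ((tendsto_const_div_atTop_nhds_zero_nat K).add (hA 0)).add
        (((hA (-h)).const_mul (1 / 2)).add ((hA h).const_mul (1 / 2)))
      simpa using this
    refine IsL1Null.of_sq (fun N => ?_)
      (fun N => (memLp_finsetSum _ fun s _ => hmp s).const_mul _) hu
      (Eventually.of_forall fun N => ?_)
    · exact (Finset.measurable_fun_sum _ fun s _ =>
        ((hX.measurable _).mul (hX.measurable _)).sub_const _).const_mul _
    · have e : ∀ ω, ((N : ℝ)⁻¹ * ∑ s ∈ Finset.Icc 1 N, (X s ω * X (s + h) ω - r)) ^ 2 =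
          ((N : ℝ)⁻¹) ^ 2 * ∑ s ∈ Finset.Icc 1 N, ∑ t ∈ Finset.Icc 1 N,
            (X s ω * X (s + h) ω - r) * (X t ω * X (t + h) ω - r) := fun ω => by
        rw [mul_pow, sq (∑ s ∈ Finset.Icc 1 N, _), Finset.sum_mul_sum]
      have hi : ∀ s t : ℕ, Integrable
          (fun ω => (X s ω * X (s + h) ω - r) * (X t ω * X (t + h) ω - r)) P :=
        fun s t => (hmp s).integrable_mul (hmp t)
      have e2 : ∫ ω, ((N : ℝ)⁻¹ * ∑ s ∈ Finset.Icc 1 N, (X s ω * X (s + h) ω - r)) ^ 2 ∂P =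
          ((N : ℝ)⁻¹) ^ 2 * ∑ s ∈ Finset.Icc 1 N, ∑ t ∈ Finset.Icc 1 N,
            (cum4 P (X 0) (X h) (X ((t : ℤ) - s)) (X ((t : ℤ) - s + h)) +
        autocov P X ((s : ℤ) - t) ^ 2 +
          autocov P X ((s : ℤ) - t - h) * autocov P X ((s : ℤ) - t + h)) := by
        simp_rw [e]
        rw [integral_const_mul, integral_finsetSum _ fun s _ => integrable_finsetSum _
          fun t _ => hi s t]
        congr 1
        refine Finset.sum_congr rfl fun s _ => ?_
        rw [integral_finsetSum _ fun t _ => hi s t]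
        exact Finset.sum_congr rfl fun t _ => covariance_products hX hX4 h s t
      rw [e2]
      have hle : ∑ s ∈ Finset.Icc 1 N, ∑ t ∈ Finset.Icc 1 N,
            (cum4 P (X 0) (X h) (X ((t : ℤ) - s)) (X ((t : ℤ) - s + h)) +
              autocov P X ((s : ℤ) - t) ^ 2 +
                autocov P X ((s : ℤ) - t - h) * autocov P X ((s : ℤ) - t + h)) ≤
          N * K + ∑ s ∈ Finset.Icc 1 N, ∑ t ∈ Finset.Icc 1 N, autocov P X ((s : ℤ) - t + 0) ^ 2 +
          (1 / 2 * ∑ s ∈ Finset.Icc 1 N, ∑ t ∈ Finset.Icc 1 N,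
              autocov P X ((s : ℤ) - t + -h) ^ 2 +
            1 / 2 * ∑ s ∈ Finset.Icc 1 N, ∑ t ∈ Finset.Icc 1 N,
              autocov P X ((s : ℤ) - t + h) ^ 2) := by
        refine le_trans ?_ (add_le_add_left (add_le_add_left (sum_sum_abs_cum4_le hX4 h N) _) _)
        simp_rw [Finset.mul_sum, ← Finset.sum_add_distrib]
        refine Finset.sum_le_sum fun s _ => Finset.sum_le_sum fun t _ => ?_
        rw [← sub_eq_add_neg, add_zero]
        refine add_le_add (add_le_add (le_abs_self _) le_rfl) ?_
        nlinarith [sq_nonneg (autocov P X ((s : ℤ) - t - h) - autocov P X ((s : ℤ) - t + h))]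
      refine (mul_le_mul_of_nonneg_left hle (by positivity)).trans (le_of_eq ?_)
      simp only [A]
      rcases Nat.eq_zero_or_pos N with rfl | hN
      · simp
      · field_simp
  refine hmain.of_le (fun N => ?_) ?_
  · exact ((Finset.measurable_fun_sum _ fun s _ =>
      ((hX.measurable _).mul (hX.measurable _))).const_mul _).sub_const _
  · filter_upwards [eventually_gt_atTop 0] with N hN ω
    rw [Finset.sum_sub_distrib, mul_sub, hrr]
    have hN' : (N : ℝ) ≠ 0 := by positivity
    simp [hN']

end Proc

/-! ### Sample autocovariances of the sinusoid model -/

section Proc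

variable {Ω : Type*} [MeasurableSpace Ω] {P : Measure Ω} {X : ℤ → Ω → ℝ}

/-- The addition formula takes the random phase out of the sum as bounded factors, leaving noise
averages with deterministic weights. -/
lemma isL1Null_phase_mul_noise [IsProbabilityMeasure P] (hX : IsSecondOrderStationary P X)
    {FX : Measure ℝ} (hFX : IsSpectralMeasure (autocov P X) FX) (hcont : ∀ x, FX {x} = 0)
    {Φ : Ω → ℝ} (hΦ : Measurable Φ) (μ c : ℝ) (k : ℤ) :
    IsL1Null P fun N ω => (N : ℝ)⁻¹ * ∑ s ∈ Finset.Icc 1 N,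
      Real.cos (μ * (s + c) + Φ ω) * X (s + k) ω := by
  have h1 := (isL1Null_weighted_average hX hFX hcont (a := fun s => Real.cos (μ * (s + c)))
    (fun s => Real.abs_cos_le_one _) k).mul_of_abs_le_one (g := fun ω => Real.cos (Φ ω))
    (by fun_prop) fun ω => Real.abs_cos_le_one _
  have h2 := (isL1Null_weighted_average hX hFX hcont (a := fun s => Real.sin (μ * (s + c)))
    (fun s => Real.abs_sin_le_one _) k).mul_of_abs_le_one (g := fun ω => -Real.sin (Φ ω))
    (by fun_prop) fun ω => by rw [abs_neg]; exact Real.abs_sin_le_one _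
  convert! h1.add h2 using 3 with N ω
  rw [mul_left_comm, mul_left_comm (-_), ← mul_add, Finset.mul_sum (a := Real.cos (Φ ω)),
    Finset.mul_sum (a := -Real.sin (Φ ω)), ← Finset.sum_add_distrib]
  congr 1
  refine Finset.sum_congr rfl fun s _ => ?_
  rw [Real.cos_add]
  ring

lemma average_cos_mul_cos (μ ν a b c : ℝ) (N : ℕ) :
    (N : ℝ)⁻¹ * ∑ s ∈ Finset.Icc 1 N, Real.cos (μ * s + a) * Real.cos (ν * (s + c) + b) =
      1 / 2 * ((N : ℝ)⁻¹ * ∑ s ∈ Finset.Icc 1 N, Real.cos ((μ - ν) * s + (a - b - ν * c))) +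
      1 / 2 * ((N : ℝ)⁻¹ * ∑ s ∈ Finset.Icc 1 N, Real.cos ((μ + ν) * s + (a + b + ν * c))) := by
  rw [← mul_add, ← mul_add, ← Finset.sum_add_distrib, mul_left_comm, Finset.mul_sum (a := 1 / 2)]
  congr 1
  refine Finset.sum_congr rfl fun s _ => ?_
  rw [show (μ - ν) * s + (a - b - ν * c) = (μ * s + a) - (ν * (s + c) + b) by ring,
    show (μ + ν) * s + (a + b + ν * c) = (μ * s + a) + (ν * (s + c) + b) by ring,
    Real.cos_sub (μ * s + a), Real.cos_add (μ * s + a) (ν * (s + c) + b)]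
  ring

lemma tendsto_norm_average_exp {μ : ℝ} (hμ : ∀ k : ℤ, μ ≠ k * (2 * Real.pi)) :
    Tendsto (fun N : ℕ =>
      ‖(N : ℂ)⁻¹ * ∑ s ∈ Finset.Icc 1 N, Complex.exp (μ * Complex.I) ^ s‖) atTop (𝓝 0) := by
  have := (tendsto_average_pow (Complex.norm_exp_ofReal_mul_I μ) fun h => by
    obtain ⟨k, hk⟩ := (exp_mul_I_eq_one_iff μ).mp h
    exact hμ k hk).norm
  rwa [norm_zero] at this

lemma isL1Null_cos_mul_cos [IsProbabilityMeasure P] {Φ Ψ : Ω → ℝ} (hΦ : Measurable Φ)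
    (hΨ : Measurable Ψ) {μ ν : ℝ} (h1 : ∀ k : ℤ, μ - ν ≠ k * (2 * Real.pi))
    (h2 : ∀ k : ℤ, μ + ν ≠ k * (2 * Real.pi)) (c : ℝ) :
    IsL1Null P fun N ω => (N : ℝ)⁻¹ * ∑ s ∈ Finset.Icc 1 N,
      Real.cos (μ * s + Φ ω) * Real.cos (ν * (s + c) + Ψ ω) := by
  have hu := ((tendsto_norm_average_exp h1).const_mul (1 / 2)).add
    ((tendsto_norm_average_exp h2).const_mul (1 / 2))
  rw [mul_zero, add_zero] at hu
  refine IsL1Null.of_deterministic (fun N => by fun_prop) hu (Eventually.of_forall fun N ω => ?_)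
  rw [average_cos_mul_cos]
  refine (abs_add_le _ _).trans ?_
  rw [abs_mul (1 / 2 : ℝ), abs_mul (1 / 2 : ℝ), abs_of_pos (by norm_num : (0 : ℝ) < 1 / 2)]
  gcongr <;> exact abs_average_cos_le _ _ _

/-- The difference frequency is zero and its phase cancels, which leaves the constant `cos (μ c) /
2`; the sum frequency averages out uniformly in the phase. -/
lemma isL1Null_cos_mul_cos_self [IsProbabilityMeasure P] {Φ : Ω → ℝ} (hΦ : Measurable Φ)
    {μ : ℝ} (h2 : ∀ k : ℤ, μ + μ ≠ k * (2 * Real.pi)) (c : ℝ) :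
    IsL1Null P fun N ω => (N : ℝ)⁻¹ * ∑ s ∈ Finset.Icc 1 N,
      Real.cos (μ * s + Φ ω) * Real.cos (μ * (s + c) + Φ ω) - Real.cos (μ * c) / 2 := by
  have hu := (tendsto_norm_average_exp h2).const_mul (1 / 2)
  rw [mul_zero] at hu
  refine IsL1Null.of_deterministic (fun N => by fun_prop) hu ?_
  filter_upwards [eventually_gt_atTop 0] with N hN ω
  have hN' : (N : ℝ) ≠ 0 := by positivity
  rw [average_cos_mul_cos]
  have e : (N : ℝ)⁻¹ * ∑ s ∈ Finset.Icc 1 N, Real.cos ((μ - μ) * s + (Φ ω - Φ ω - μ * c)) =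
      Real.cos (μ * c) := by
    simp [hN']
  rw [e, show ∀ a b : ℝ, 1 / 2 * a + b - a / 2 = b by intros; ring, abs_mul,
    abs_of_pos (by norm_num : (0 : ℝ) < 1 / 2)]
  gcongr
  exact abs_average_cos_le _ _ _

lemma sum_mul_expand {ι κ : Type*} (S : Finset ι) (T : Finset κ) (r : κ → ℝ) (u v : κ → ι → ℝ)
    (x y : ι → ℝ) :
    ∑ s ∈ S, (∑ i ∈ T, r i * u i s + x s) * (∑ j ∈ T, r j * v j s + y s) =
      ∑ i ∈ T, ∑ j ∈ T, r i * r j * ∑ s ∈ S, u i s * v j s +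
        ∑ i ∈ T, r i * ∑ s ∈ S, u i s * y s + ∑ j ∈ T, r j * ∑ s ∈ S, v j s * x s +
        ∑ s ∈ S, x s * y s := by
  have e : ∀ s, (∑ i ∈ T, r i * u i s + x s) * (∑ j ∈ T, r j * v j s + y s) =
      ∑ i ∈ T, ∑ j ∈ T, r i * r j * (u i s * v j s) + ∑ i ∈ T, r i * (u i s * y s) +
        ∑ j ∈ T, r j * (v j s * x s) + x s * y s := fun s => by
    rw [add_mul, mul_add, mul_add, Finset.sum_mul_sum, Finset.sum_mul, Finset.mul_sum]
    rw [← add_assoc]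
    congr 1
    congr 1
    · congr 1
      · exact Finset.sum_congr rfl fun i _ => Finset.sum_congr rfl fun j _ => by ring
      · exact Finset.sum_congr rfl fun i _ => by ring
    · exact Finset.sum_congr rfl fun i _ => by ring
  simp_rw [e, Finset.sum_add_distrib, Finset.mul_sum]
  congr 1
  congr 1
  · congr 1
    · rw [Finset.sum_comm]
      exact Finset.sum_congr rfl fun i _ => Finset.sum_comm
    · exact Finset.sum_comm
  · exact Finset.sum_comm

variable {J : ℕ} {R freq : Fin J → ℝ} {Φ : Fin J → Ω → ℝ}

lemma measurable_sinusoidModel (hX : ∀ t, Measurable (X t)) (hΦ : ∀ j, Measurable (Φ j)) (t : ℤ) :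
    Measurable (sinusoidModel R freq Φ X t) := by
  have h : sinusoidModel R freq Φ X t =
      fun ω => ∑ j, R j * Real.cos (freq j * t + Φ j ω) + X t ω := rfl
  rw [h]
  exact (Finset.measurable_fun_sum _ fun j _ => by fun_prop).add (hX t)

/-- The product expands into sinusoid pairs, two kinds of cross terms and noise products, each null
after centring. Proper frequencies are what removes the off-diagonal pairs and the doubled
frequencies. -/
lemma isL1Null_sinusoid_average [IsProbabilityMeasure P] (hX : IsSecondOrderStationary P X)
    (hX4 : HasSummableFourthCumulants P X)
    {FX : Measure ℝ} (hFX : IsSpectralMeasure (autocov P X) FX) (hcont : ∀ x, FX {x} = 0)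
    (hfreq : AreProperFrequencies R freq) (hΦ : ∀ j, Measurable (Φ j)) (h : ℤ) :
    IsL1Null P fun N ω => (N : ℝ)⁻¹ * ∑ s ∈ Finset.Icc 1 N,
        sinusoidModel R freq Φ X s ω * sinusoidModel R freq Φ X (s + h) ω -
      (autocov P X h + ∑ j, R j ^ 2 / 2 * Real.cos (freq j * h)) := by
  have hDD : ∀ i j, IsL1Null P fun N ω => R i * R j * ((N : ℝ)⁻¹ * ∑ s ∈ Finset.Icc 1 N,
      Real.cos (freq i * s + Φ i ω) * Real.cos (freq j * (s + h) + Φ j ω) -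
        if i = j then Real.cos (freq j * h) / 2 else 0) := by
    intro i j
    by_cases hi : R i = 0
    · simpa [hi] using IsL1Null.zero
    by_cases hj : R j = 0
    · simpa [hj] using IsL1Null.zero
    refine IsL1Null.const_mul ?_ _
    by_cases hij : i = j
    · subst hij
      simp only [if_true]
      refine isL1Null_cos_mul_cos_self (hΦ i) (fun k hk => ?_) _
      exact hfreq.ne_int_mul_pi i hi k (by linarith)
    · simp only [if_neg hij, sub_zero]
      refine isL1Null_cos_mul_cos (hΦ i) (hΦ j) (fun k hk => ?_) (fun k hk => ?_) _
      · exact hfreq.ne_add i j hij hi hj k (by linarith)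
      · exact hfreq.ne_neg_add i j hij hi hj k (by linarith)
  have hDX : ∀ i, IsL1Null P fun N ω => R i * ((N : ℝ)⁻¹ * ∑ s ∈ Finset.Icc 1 N,
      Real.cos (freq i * (s + (0 : ℝ)) + Φ i ω) * X (s + h) ω) := fun i =>
    (isL1Null_phase_mul_noise hX hFX hcont (hΦ i) (freq i) 0 h).const_mul _
  have hXD : ∀ i, IsL1Null P fun N ω => R i * ((N : ℝ)⁻¹ * ∑ s ∈ Finset.Icc 1 N,
      Real.cos (freq i * (s + (h : ℝ)) + Φ i ω) * X (s + 0) ω) := fun i =>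
    (isL1Null_phase_mul_noise hX hFX hcont (hΦ i) (freq i) h 0).const_mul _
  have hall := (((IsL1Null.sum Finset.univ fun i _ =>
    IsL1Null.sum Finset.univ fun j _ => hDD i j).add
    (IsL1Null.sum Finset.univ fun i _ => hDX i)).add
    (IsL1Null.sum Finset.univ fun i _ => hXD i)).add (isL1Null_noise_autocov hX hX4 hFX hcont h)
  convert! hall using 3 with N ω
  simp only [sinusoidModel, Int.cast_natCast, Int.cast_add, add_zero]
  rw [sum_mul_expand, mul_add, mul_add, mul_add]
  have e : ∑ i, ∑ j, R i * R j * ((N : ℝ)⁻¹ * ∑ s ∈ Finset.Icc 1 N,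
      Real.cos (freq i * s + Φ i ω) * Real.cos (freq j * (s + h) + Φ j ω) -
        if i = j then Real.cos (freq j * h) / 2 else 0) =
      (N : ℝ)⁻¹ * (∑ i, ∑ j, R i * R j * ∑ s ∈ Finset.Icc 1 N,
        Real.cos (freq i * s + Φ i ω) * Real.cos (freq j * (s + h) + Φ j ω)) -
          ∑ j, R j ^ 2 / 2 * Real.cos (freq j * h) := by
    simp_rw [mul_sub, Finset.sum_sub_distrib, mul_ite, mul_zero, Finset.sum_ite_eq,
      Finset.mem_univ, if_true]
    congr 1
    · rw [Finset.mul_sum (a := (N : ℝ)⁻¹)]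
      refine Finset.sum_congr rfl fun i _ => ?_
      rw [Finset.mul_sum (a := (N : ℝ)⁻¹)]
      exact Finset.sum_congr rfl fun j _ => mul_left_comm _ _ _
    · exact Finset.sum_congr rfl fun j _ => by ring
  rw [e]
  simp_rw [mul_left_comm (R _) (N : ℝ)⁻¹, ← Finset.mul_sum (a := (N : ℝ)⁻¹)]
  ring

/-! ### Autocovariance of the model and a uniform moment bound -/

lemma integral_comp_uniform {Ψ : Ω → ℝ} (hm : Measurable Ψ)
    (hu : pdf.IsUniform Ψ (Set.Ioo (-Real.pi) Real.pi) P volume) {g : ℝ → ℝ} (hg : Continuous g) :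
    ∫ ω, g (Ψ ω) ∂P = (2 * Real.pi)⁻¹ * ∫ x in (-Real.pi)..Real.pi, g x := by
  have hpi := Real.pi_pos
  rw [← integral_map hm.aemeasurable hg.aestronglyMeasurable, hu, ProbabilityTheory.cond,
    integral_smul_measure, intervalIntegral.integral_of_le (by linarith),
    integral_Ioc_eq_integral_Ioo, Real.volume_Ioo, sub_neg_eq_add, ← two_mul, ENNReal.toReal_inv,
    ENNReal.toReal_ofReal (by positivity), smul_eq_mul]

lemma integral_cos_phase {Ψ : Ω → ℝ} (hm : Measurable Ψ)
    (hu : pdf.IsUniform Ψ (Set.Ioo (-Real.pi) Real.pi) P volume) (a : ℝ) :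
    ∫ ω, Real.cos (a + Ψ ω) ∂P = 0 := by
  rw [integral_comp_uniform hm hu (g := fun x => Real.cos (a + x)) (by fun_prop)]
  simp [intervalIntegral.integral_comp_add_left (fun x => Real.cos x), Real.sin_add]

lemma integral_cos_mul_cos_phase {Ψ : Ω → ℝ} (hm : Measurable Ψ)
    (hu : pdf.IsUniform Ψ (Set.Ioo (-Real.pi) Real.pi) P volume) (a b : ℝ) :
    ∫ ω, Real.cos (a + Ψ ω) * Real.cos (b + Ψ ω) ∂P = Real.cos (a - b) / 2 := by
  have hpi := Real.pi_pos
  rw [integral_comp_uniform hm hu (g := fun x => Real.cos (a + x) * Real.cos (b + x))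
    (by fun_prop)]
  have e : ∫ x in (-Real.pi)..Real.pi, Real.cos (a + x) * Real.cos (b + x) =
      Real.pi * Real.cos (a - b) := by
    rw [intervalIntegral.integral_eq_sub_of_hasDerivAt
      (f := fun x => x * Real.cos (a - b) / 2 + Real.sin (a + b + 2 * x) / 4)
      (fun x _ => ?_) ((by fun_prop : Continuous _).intervalIntegrable _ _)]
    · have e1 : Real.sin (a + b + 2 * Real.pi) = Real.sin (a + b) := Real.sin_add_two_pi _
      have e2 : Real.sin (a + b + 2 * -Real.pi) = Real.sin (a + b) := by
        rw [mul_neg, ← sub_eq_add_neg]; exact Real.sin_sub_two_pi _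
      rw [e1, e2]
      ring
    · have h0 : HasDerivAt (fun x : ℝ => a + b + 2 * x) 2 x := by
        simpa using ((hasDerivAt_id x).const_mul 2).const_add (a + b)
      have h1 := (((hasDerivAt_id x).mul_const (Real.cos (a - b))).div_const 2).add
        (h0.sin.div_const 4)
      convert! h1 using 1
      rw [show a - b = (a + x) - (b + x) by ring, show a + b + 2 * x = (a + x) + (b + x) by ring,
        Real.cos_sub (a + x), Real.cos_add (a + x)]
      ring
  rw [e]
  field_simp

lemma memLp_cos [IsProbabilityMeasure P] {Ψ : Ω → ℝ} (hm : Measurable Ψ) (a : ℝ) :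
    MemLp (fun ω => Real.cos (a + Ψ ω)) 2 P :=
  MemLp.of_bound (by fun_prop) 1 (ae_of_all _ fun ω => Real.abs_cos_le_one _)

/-- The autocovariance function of noise plus sinusoids with random phases. -/
lemma autocov_sinusoidModel [IsProbabilityMeasure P] (hX : IsSecondOrderStationary P X)
    (hΦ : IsRandomPhase P X Φ) (h : ℤ) :
    autocov P (sinusoidModel R freq Φ X) h =
      autocov P X h + ∑ j, R j ^ 2 / 2 * Real.cos (freq j * h) := by
  let D : ℤ → Ω → ℝ := fun t ω => ∑ j, R j * Real.cos (freq j * t + Φ j ω)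
  have hDL : ∀ t, MemLp (D t) 2 P := fun t =>
    memLp_finsetSum _ fun j _ => (memLp_cos (hΦ.measurable j) _).const_mul _
  have hY : ∀ t, sinusoidModel R freq Φ X t = D t + X t := fun t => rfl
  have hind : ∀ s t, IndepFun (D s) (X t) P := fun s t => by
    refine hΦ.indep_process.comp (φ := fun x : Fin J → ℝ =>
      ∑ j, R j * Real.cos (freq j * s + x j)) (ψ := fun x : ℤ → ℝ => x t) ?_
      (measurable_pi_apply t)
    fun_prop
  have hDD : covariance (D h) (D 0) P = ∑ j, R j ^ 2 / 2 * Real.cos (freq j * h) := by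
    rw [covariance_fun_sum_fun_sum
      (fun j => (memLp_cos (hΦ.measurable j) (freq j * h)).const_mul (R j))
      (fun j => (memLp_cos (hΦ.measurable j) (freq j * (0 : ℤ))).const_mul (R j))]
    refine Finset.sum_congr rfl fun i _ => ?_
    rw [Finset.sum_eq_single i]
    · rw [covariance_const_mul_left, covariance_const_mul_right,
        covariance_eq_sub (memLp_cos (hΦ.measurable i) _) (memLp_cos (hΦ.measurable i) _),
        integral_cos_phase (hΦ.measurable i) (hΦ.uniform i)]
      have := integral_cos_mul_cos_phase (hΦ.measurable i) (hΦ.uniform i) (freq i * h)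
        (freq i * (0 : ℤ))
      simp only [Pi.mul_apply]
      rw [this]
      simp
      ring
    · intro j _ hji
      rw [covariance_const_mul_left, covariance_const_mul_right,
        IndepFun.covariance_eq_zero _ (memLp_cos (hΦ.measurable i) _)
          (memLp_cos (hΦ.measurable j) _), mul_zero, mul_zero]
      exact (hΦ.indep.indepFun hji.symm).comp (φ := fun x => Real.cos (freq i * h + x))
        (ψ := fun x => Real.cos (freq j * (0 : ℤ) + x)) (by fun_prop) (by fun_prop)
    · simp
  rw [autocov, hY, hY, covariance_add_left (hDL _) (hX.memLp_two _)
    ((hDL _).add (hX.memLp_two _)), covariance_add_right (hDL _) (hDL _) (hX.memLp_two _),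
    covariance_add_right (hX.memLp_two _) (hDL _) (hX.memLp_two _), hDD,
    (hind _ _).covariance_eq_zero (hDL _) (hX.memLp_two _),
    (hind _ _).symm.covariance_eq_zero (hX.memLp_two _) (hDL _), autocov]
  ring

/-- The averages in the sample autocovariances are bounded in mean. -/
lemma exists_lintegral_average_le [IsProbabilityMeasure P] (hX : IsSecondOrderStationary P X)
    (hΦ : ∀ j, Measurable (Φ j)) :
    ∃ B : ENNReal, B ≠ ⊤ ∧ ∀ (N : ℕ) (h : ℤ), ∫⁻ ω, ‖(N : ℝ)⁻¹ * ∑ s ∈ Finset.Icc 1 N,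
      sinusoidModel R freq Φ X s ω * sinusoidModel R freq Φ X (s + h) ω‖ₑ ∂P ≤ B := by
  set Y := sinusoidModel R freq Φ X
  have hYm : ∀ t, Measurable (Y t) := measurable_sinusoidModel hX.measurable hΦ
  set M := ∑ j, |R j|
  -- The sinusoidal part is bounded by `M`, and `2|ab| ≤ a² + b²` turns this into a bound for
  -- products that does not depend on the times.
  have hsq : ∀ t ω, Y t ω ^ 2 ≤ 2 * M ^ 2 + 2 * X t ω ^ 2 := fun t ω => by
    have hD : |∑ j, R j * Real.cos (freq j * t + Φ j ω)| ≤ M := by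
      refine (Finset.abs_sum_le_sum_abs _ _).trans (Finset.sum_le_sum fun j _ => ?_)
      rw [abs_mul]
      exact mul_le_of_le_one_right (abs_nonneg _) (Real.abs_cos_le_one _)
    have h1 : Y t ω = ∑ j, R j * Real.cos (freq j * t + Φ j ω) + X t ω := rfl
    rw [h1]
    have h2 := sq_le_sq' (abs_le.mp hD).1 (abs_le.mp hD).2
    nlinarith [sq_nonneg (∑ j, R j * Real.cos (freq j * t + Φ j ω) - X t ω)]
  have hX2 : ∀ t, Integrable (fun ω => X t ω ^ 2) P := fun t => (hX.memLp_two t).integrable_sq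
  set B := ENNReal.ofReal (2 * M ^ 2 + (autocov P X 0 + autocov P X 0))
  have hprod : ∀ s t, ∫⁻ ω, ‖Y s ω * Y t ω‖ₑ ∂P ≤ B := fun s t => by
    have hint : Integrable (fun ω => 2 * M ^ 2 + (X s ω ^ 2 + X t ω ^ 2)) P :=
      (integrable_const _).add ((hX2 s).add (hX2 t))
    have e : ∫ ω, 2 * M ^ 2 + (X s ω ^ 2 + X t ω ^ 2) ∂P =
        2 * M ^ 2 + (autocov P X 0 + autocov P X 0) := by
      have e2 : ∀ t, ∫ ω, X t ω ^ 2 ∂P = autocov P X 0 := fun t => by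
        have := hX.integral_mul t t
        rw [sub_self] at this
        simp_rw [sq]
        exact this
      have hi : Integrable (fun ω => X s ω ^ 2 + X t ω ^ 2) P := (hX2 s).add (hX2 t)
      rw [integral_add (integrable_const _) hi, integral_add (hX2 s) (hX2 t),
        e2, e2]
      simp
    simp only [B]
    rw [← e, ofReal_integral_eq_lintegral_ofReal hint (ae_of_all _ fun ω => by positivity)]
    refine lintegral_mono fun ω => ?_
    rw [Real.enorm_eq_ofReal_abs]
    refine ENNReal.ofReal_le_ofReal ?_
    rw [abs_mul]
    have := two_mul_le_add_sq |Y s ω| |Y t ω|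
    rw [sq_abs, sq_abs] at this
    linarith [hsq s ω, hsq t ω]
  refine ⟨B, ENNReal.ofReal_ne_top, fun N h => ?_⟩
  simp_rw [enorm_mul]
  have hsm : Measurable fun ω => ∑ s ∈ Finset.Icc 1 N, Y s ω * Y (s + h) ω :=
    Finset.measurable_fun_sum _ fun s _ => (hYm _).mul (hYm _)
  rw [lintegral_const_mul _ hsm.enorm]
  have h1 : ∫⁻ ω, ‖∑ s ∈ Finset.Icc 1 N, Y s ω * Y (s + h) ω‖ₑ ∂P ≤ N * B := by
    calc _ ≤ ∫⁻ ω, ∑ s ∈ Finset.Icc 1 N, ‖Y s ω * Y (s + h) ω‖ₑ ∂P :=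
          lintegral_mono fun ω => enorm_sum_le _ _
      _ = ∑ s ∈ Finset.Icc 1 N, ∫⁻ ω, ‖Y s ω * Y (s + h) ω‖ₑ ∂P :=
          lintegral_finsetSum _ fun s _ => ((hYm _).mul (hYm _)).enorm
      _ ≤ ∑ s ∈ Finset.Icc 1 N, B := Finset.sum_le_sum fun s _ => hprod _ _
      _ = N * B := by simp
  rcases Nat.eq_zero_or_pos N with rfl | hN
  · simp
  · calc _ ≤ ‖(N : ℝ)⁻¹‖ₑ * (N * B) := by gcongr
      _ = B := by
        have hN' : (N : ℝ) ≠ 0 := by positivity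
        have : ((N : ℕ) : ENNReal) = ‖(N : ℝ)‖ₑ := by simp
        rw [this, ← mul_assoc, ← enorm_mul, inv_mul_cancel₀ hN']
        simp

end Proc

/-! ### Uniform convergence of the objectives and consistency -/

/-- The windowed sample autocovariances, extended by zero. -/
def windowedAutocov (φ : ℝ → ℝ) (m : ℕ) (y : ℤ → ℝ) (n : ℕ) (h : ℤ) : ℝ :=
  if h ∈ Finset.Icc (-(m : ℤ)) m then φ ((h : ℝ) / m) * sampleAutocov y n h else 0

lemma hasSum_windowedAutocov (φ : ℝ → ℝ) {m n : ℕ} (hmn : m < n) (p : ℝ) (y : ℤ → ℝ) (θ : ℝ) :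
    HasSum (fun h => windowedAutocov φ m y n h * checkCoeff p h θ) (objective φ m p y n θ) := by
  have h := hasSum_sum_of_ne_finset_zero
    (f := fun h => windowedAutocov φ m y n h * checkCoeff p h θ) (s := Finset.Icc (-(m : ℤ)) m)
    (L := SummationFilter.unconditional ℤ) fun h hh => by
      simp only [windowedAutocov, if_neg hh, zero_mul]
  convert! h using 1
  rw [objective_eq φ hmn]
  refine Finset.sum_congr rfl fun h hh => ?_
  rw [windowedAutocov, if_pos hh]

/-- The uniform distance between the objective function and its limit. -/
lemma enorm_objective_sub_le (φ : ℝ → ℝ) {m n : ℕ} (hmn : m < n) {R : ℤ → ℝ} {F : Measure ℝ}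
    (hF : IsSpectralMeasure R F) (h1 : F {Real.pi} = 0) (h2 : F {-Real.pi} = 0) {p θ : ℝ}
    (hp : p ∈ Set.Icc (0 : ℝ) 1) (hθ : θ ∈ Lam) (y : ℤ → ℝ) :
    ‖objective φ m p y n θ - Real.pi * limitObjective F p θ‖ₑ ≤
      ∑' h : ℤ, ENNReal.ofReal (checkWeight h) * ‖windowedAutocov φ m y n h - R h‖ₑ := by
  have hs := (hasSum_windowedAutocov φ hmn p y θ).sub (hasSum_autocov_mul_checkCoeff hF h1 h2 hp hθ)
  rw [← hs.tsum_eq]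
  refine enorm_tsum_le_tsum_enorm.trans (ENNReal.tsum_le_tsum fun h => ?_)
  rw [← sub_mul, enorm_mul, mul_comm, Real.enorm_eq_ofReal_abs (checkCoeff p h θ)]
  gcongr
  exact abs_checkCoeff_le hp hθ h

lemma IsWindow.abs_window_le {φ : ℝ → ℝ} {m : ℕ → ℕ} (hφ : IsWindow φ m) {n : ℕ} {h : ℤ}
    (hh : h.natAbs ≤ m n) : |φ ((h : ℝ) / m n)| ≤ 1 := by
  have h1 : |(h : ℝ) / m n| ≤ 1 := by
    rw [abs_div, Nat.abs_cast, ← Int.cast_abs, Int.abs_eq_natAbs, Int.cast_natCast]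
    exact div_le_one_of_le₀ (Nat.cast_le.mpr hh) (Nat.cast_nonneg _)
  have h2 := Real.pi_gt_three
  have h3 := _root_.abs_le.mp h1
  exact hφ.abs_le_one _ ⟨by linarith [h3.1], by linarith [h3.2]⟩

lemma IsWindow.eventually_lt {φ : ℝ → ℝ} {m : ℕ → ℕ} (hφ : IsWindow φ m) :
    ∀ᶠ n in atTop, m n < n := by
  filter_upwards [hφ.m_div_tendsto.eventually_lt_const one_pos, eventually_gt_atTop 0]
    with n hn hn0
  rw [div_lt_one (by positivity)] at hn
  exact_mod_cast hn

section Proc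

variable {Ω : Type*} [MeasurableSpace Ω] {P : Measure Ω} {X : ℤ → Ω → ℝ}

lemma IsL1Null.comp {f : ℕ → Ω → ℝ} (hf : IsL1Null P f) {k : ℕ → ℕ} (hk : Tendsto k atTop atTop) :
    IsL1Null P fun n => f (k n) :=
  ⟨fun n => hf.measurable (k n), hf.tendsto.comp hk⟩

lemma sampleAutocov_eq (y : ℤ → ℝ) {n : ℕ} {h : ℤ} (hn : h.natAbs ≤ n) :
    sampleAutocov y n h = ((n - h.natAbs : ℕ) : ℝ)⁻¹ *
      ∑ s ∈ Finset.Icc 1 (n - h.natAbs), y s * y (s + h.natAbs) := by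
  rw [sampleAutocov, Nat.cast_sub hn]

lemma measurable_sampleAutocov {Y : ℤ → Ω → ℝ} (hY : ∀ t, Measurable (Y t)) (n : ℕ) (h : ℤ) :
    Measurable fun ω => sampleAutocov (fun t => Y t ω) n h :=
  (Finset.measurable_fun_sum _ fun _ _ => (hY _).mul (hY _)).const_mul _

lemma measurable_windowedAutocov {Y : ℤ → Ω → ℝ} (hY : ∀ t, Measurable (Y t)) (φ : ℝ → ℝ)
    (m n : ℕ) (h : ℤ) : Measurable fun ω => windowedAutocov φ m (fun t => Y t ω) n h := by
  unfold windowedAutocov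
  split_ifs
  · exact (measurable_sampleAutocov hY n h).const_mul _
  · exact measurable_const

variable {J : ℕ} {R freq : Fin J → ℝ} {Φ : Fin J → Ω → ℝ}

lemma IsSpectralMeasure.autocov_natAbs {r : ℤ → ℝ} {F : Measure ℝ} (hF : IsSpectralMeasure r F)
    (h : ℤ) : r h.natAbs = r h := by
  rcases Int.natAbs_eq h with e | e
  · rw [← e]
  · conv_rhs => rw [e, hF.even]

lemma IsSpectralMeasure.abs_le {r : ℤ → ℝ} {F : Measure ℝ} (hF : IsSpectralMeasure r F)
    (h : ℤ) : |r h| ≤ F.real Set.univ := by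
  have := hF.finite
  rw [hF.eq_integral_cos]
  have := norm_integral_le_of_norm_le_const (μ := F) (f := fun x => Real.cos (h * x)) (C := 1)
    (ae_of_all _ fun x => Real.abs_cos_le_one _)
  simpa using this

/-- At a fixed lag the window tends to one, by continuity at zero; the error splits as `φ (C - r) +
(φ - 1) r`. -/
lemma isL1Null_windowedAutocov [IsProbabilityMeasure P] {Y : ℤ → Ω → ℝ}
    (hY : ∀ t, Measurable (Y t)) {φ : ℝ → ℝ} {m : ℕ → ℕ} (hφ : IsWindow φ m) {h : ℤ} {r : ℝ}
    (hC : IsL1Null P fun n ω => sampleAutocov (fun t => Y t ω) n h - r) :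
    IsL1Null P fun n ω => windowedAutocov φ (m n) (fun t => Y t ω) n h - r := by
  have hlim : Tendsto (fun n => (h : ℝ) / m n) atTop (𝓝 0) :=
    (tendsto_const_div_atTop_nhds_zero_nat (h : ℝ)).comp hφ.m_tendsto
  have hφlim : Tendsto (fun n => (φ ((h : ℝ) / m n) - 1) * r) atTop (𝓝 0) := by
    have h1 := (hφ.continuousAt_zero.tendsto.comp hlim)
    rw [hφ.at_zero] at h1
    simpa using (h1.sub_const 1).mul_const r
  have hd : IsL1Null P fun n (_ : Ω) => |(φ ((h : ℝ) / m n) - 1) * r| :=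
    IsL1Null.of_deterministic (fun _ => measurable_const) (by simpa using hφlim.abs)
      (Eventually.of_forall fun n ω => (abs_abs _).le)
  have hC' : IsL1Null P fun n ω => |sampleAutocov (fun t => Y t ω) n h - r| :=
    hC.of_le (fun n => (hC.measurable n).abs) (Eventually.of_forall fun n ω => (abs_abs _).le)
  refine (hC'.add hd).of_le
    (fun n => (measurable_windowedAutocov hY φ (m n) n h).sub_const r) ?_
  filter_upwards [hφ.m_tendsto.eventually_ge_atTop h.natAbs] with n hn ω
  rw [windowedAutocov, if_pos (Finset.mem_Icc.mpr ⟨by omega, by omega⟩)]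
  have hle := hφ.abs_window_le hn
  set C := sampleAutocov (fun t => Y t ω) n h
  refine le_trans ?_ (le_abs_self _)
  calc |φ (h / m n) * C - r| = |φ (h / m n) * (C - r) + (φ (h / m n) - 1) * r| := by ring_nf
    _ ≤ |φ (h / m n) * (C - r)| + |(φ (h / m n) - 1) * r| := abs_add_le _ _
    _ ≤ _ := by
      refine add_le_add ?_ le_rfl
      rw [abs_mul]
      exact mul_le_of_le_one_left (abs_nonneg _) hle

/-- This supplies the dominating function over the lags. Normalizing by `n - |h|` makes every sample
autocovariance a true average, so one `B` serves all lags. -/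
lemma lintegral_windowedAutocov_sub_le [IsProbabilityMeasure P] {Y : ℤ → Ω → ℝ}
    {φ : ℝ → ℝ} {m : ℕ → ℕ} (hφ : IsWindow φ m) {B : ENNReal}
    (hB : ∀ (N : ℕ) (h : ℤ), ∫⁻ ω, ‖(N : ℝ)⁻¹ * ∑ s ∈ Finset.Icc 1 N, Y s ω * Y (s + h) ω‖ₑ ∂P ≤ B)
    {n : ℕ} (hmn : m n < n) (h : ℤ) (r : ℝ) :
    ∫⁻ ω, ‖windowedAutocov φ (m n) (fun t => Y t ω) n h - r‖ₑ ∂P ≤ B + ‖r‖ₑ := by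
  have h1 : ∫⁻ ω, ‖windowedAutocov φ (m n) (fun t => Y t ω) n h‖ₑ ∂P ≤ B := by
    by_cases hh : h ∈ Finset.Icc (-(m n : ℤ)) (m n)
    · simp only [windowedAutocov, if_pos hh]
      rw [Finset.mem_Icc] at hh
      have hm : h.natAbs ≤ m n := by omega
      refine le_trans (lintegral_mono fun ω => ?_) (hB (n - h.natAbs) h.natAbs)
      rw [enorm_mul, ← sampleAutocov_eq (fun t => Y t ω) (hm.trans hmn.le)]
      refine mul_le_of_le_one_left bot_le ?_
      rw [Real.enorm_eq_ofReal_abs]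
      exact ENNReal.ofReal_le_one.mpr (hφ.abs_window_le hm)
    · simp only [windowedAutocov, if_neg hh, enorm_zero, lintegral_zero]
      exact bot_le
  calc _ ≤ ∫⁻ ω, ‖windowedAutocov φ (m n) (fun t => Y t ω) n h‖ₑ + ‖r‖ₑ ∂P :=
        lintegral_mono fun ω => enorm_sub_le
    _ = ∫⁻ ω, ‖windowedAutocov φ (m n) (fun t => Y t ω) n h‖ₑ ∂P + ‖r‖ₑ := by
        rw [lintegral_add_right _ measurable_const]; simp
    _ ≤ _ := by gcongr

/-- The mean of the uniform distance between the objective function and its limit vanishes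
asymptotically. -/
lemma tendsto_lintegral_distance [IsProbabilityMeasure P] {Y : ℤ → Ω → ℝ}
    (hY : ∀ t, Measurable (Y t)) {φ : ℝ → ℝ} {m : ℕ → ℕ} (hφ : IsWindow φ m) {r : ℤ → ℝ}
    {F : Measure ℝ} (hF : IsSpectralMeasure r F) {B : ENNReal} (hBtop : B ≠ ⊤)
    (hB : ∀ (N : ℕ) (h : ℤ), ∫⁻ ω, ‖(N : ℝ)⁻¹ * ∑ s ∈ Finset.Icc 1 N, Y s ω * Y (s + h) ω‖ₑ ∂P ≤ B)
    (hC : ∀ h : ℤ, IsL1Null P fun N ω =>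
      (N : ℝ)⁻¹ * ∑ s ∈ Finset.Icc 1 N, Y s ω * Y (s + h) ω - r h) :
    Tendsto (fun n => ∫⁻ ω, ∑' h : ℤ, ENNReal.ofReal (checkWeight h) *
      ‖windowedAutocov φ (m n) (fun t => Y t ω) n h - r h‖ₑ ∂P) atTop (𝓝 0) := by
  have hW : ∀ h, IsL1Null P fun n ω => windowedAutocov φ (m n) (fun t => Y t ω) n h - r h := by
    intro h
    refine isL1Null_windowedAutocov hY hφ ?_
    refine ((hC h.natAbs).comp (tendsto_sub_atTop_nat h.natAbs)).of_le
      (fun n => (measurable_sampleAutocov hY n h).sub_const _) ?_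
    filter_upwards [eventually_ge_atTop h.natAbs] with n hn ω
    rw [sampleAutocov_eq _ hn, hF.autocov_natAbs]
  -- The sum over lags becomes an integral against counting measure, ready for dominated
  -- convergence.
  have e : ∀ n, ∫⁻ ω, ∑' h : ℤ, ENNReal.ofReal (checkWeight h) *
      ‖windowedAutocov φ (m n) (fun t => Y t ω) n h - r h‖ₑ ∂P =
      ∫⁻ h : ℤ, ENNReal.ofReal (checkWeight h) *
        ∫⁻ ω, ‖windowedAutocov φ (m n) (fun t => Y t ω) n h - r h‖ₑ ∂P ∂Measure.count := by
    intro n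
    rw [lintegral_count, lintegral_tsum
      fun h => (((hW h).measurable n).enorm.const_mul _).aemeasurable]
    exact tsum_congr fun h => lintegral_const_mul _ ((hW h).measurable n).enorm
  simp_rw [e]
  have h0 : ∫⁻ _ : ℤ, (0 : ENNReal) ∂Measure.count = 0 := lintegral_zero
  rw [← h0]
  refine tendsto_lintegral_filter_of_dominated_convergence
    (fun h => ENNReal.ofReal (checkWeight h) * (B + ENNReal.ofReal (F.real Set.univ)))
    (Eventually.of_forall fun n => measurable_from_top) ?_ ?_ (ae_of_all _ fun h => ?_)
  · filter_upwards [hφ.eventually_lt] with n hn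
    refine ae_of_all _ fun h => ?_
    gcongr
    refine (lintegral_windowedAutocov_sub_le hφ hB hn h (r h)).trans ?_
    gcongr
    rw [Real.enorm_eq_ofReal_abs]
    exact ENNReal.ofReal_le_ofReal (hF.abs_le h)
  · rw [lintegral_count, ENNReal.tsum_mul_right]
    exact ENNReal.mul_ne_top summable_checkWeight.tsum_ofReal_ne_top
      (ENNReal.add_ne_top.mpr ⟨hBtop, ENNReal.ofReal_ne_top⟩)
  · have := ENNReal.Tendsto.const_mul (hW h).tendsto (a := ENNReal.ofReal (checkWeight h))
      (Or.inr ENNReal.ofReal_ne_top)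
    rwa [mul_zero] at this

/-- Minimizers of the objective functions are consistent as soon as the objective functions
converge uniformly in mean. -/
lemma tendstoInMeasure_of_distance [IsProbabilityMeasure P] {Y : ℤ → Ω → ℝ}
    (hY : ∀ t, Measurable (Y t)) {φ : ℝ → ℝ} {m : ℕ → ℕ} (hφ : IsWindow φ m) {r : ℤ → ℝ}
    {F : Measure ℝ} (hF : IsSpectralMeasure r F) (h1 : F {Real.pi} = 0) (h2 : F {-Real.pi} = 0)
    (hpos : 0 < spectralCDF F Real.pi) {p : ℝ} (hp : p ∈ Set.Icc (0 : ℝ) 1)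
    (huniq : ∀ x ∈ Lam, spectralQuantile F p < x → p * spectralCDF F Real.pi < spectralCDF F x)
    (hlim : Tendsto (fun n => ∫⁻ ω, ∑' h : ℤ, ENNReal.ofReal (checkWeight h) *
      ‖windowedAutocov φ (m n) (fun t => Y t ω) n h - r h‖ₑ ∂P) atTop (𝓝 0))
    {est : ℕ → Ω → ℝ}
    (hest : ∀ n ω, est n ω ∈ Lam ∧
      IsMinOn (objective φ (m n) p (fun t => Y t ω) n) Lam (est n ω)) :
    TendstoInMeasure P est atTop (fun _ => spectralQuantile F p) := by
  have := hF.finite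
  have hpi := Real.pi_pos
  have hl := spectralQuantile_mem hpos hp.2
  rw [tendstoInMeasure_iff_dist]
  intro ε hε
  obtain ⟨δ, hδ, hgap⟩ := exists_limitObjective_gap hF.support hpos hp.2 huniq hε
  set Z : ℕ → Ω → ENNReal := fun n ω => ∑' h : ℤ, ENNReal.ofReal (checkWeight h) *
    ‖windowedAutocov φ (m n) (fun t => Y t ω) n h - r h‖ₑ with hZ
  have hZm : ∀ n, Measurable (Z n) := fun n => Measurable.tsum fun h =>
    ((measurable_windowedAutocov hY φ (m n) n h).sub_const _).enorm.const_mul _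
  -- Errors below `πδ/2` at both the estimate and the quantile cannot bridge the gap `πδ` of the
  -- scaled limit. Markov's inequality is applied to the measurable `Z n`, so the estimator itself
  -- may be non-measurable.
  set c := ENNReal.ofReal (Real.pi * δ / 2)
  have hc : c ≠ 0 := (ENNReal.ofReal_pos.mpr (by positivity)).ne'
  have hlim2 : Tendsto (fun n => (∫⁻ ω, Z n ω ∂P) / c) atTop (𝓝 0) := by
    have := ENNReal.Tendsto.div_const hlim (Or.inr hc)
    rwa [ENNReal.zero_div] at this
  refine tendsto_of_tendsto_of_tendsto_of_le_of_le' tendsto_const_nhds hlim2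
    (Eventually.of_forall fun n => bot_le) ?_
  filter_upwards [hφ.eventually_lt] with n hn
  refine le_trans (measure_mono fun ω hω => ?_)
    (meas_ge_le_lintegral_div (hZm n).aemeasurable hc ENNReal.ofReal_ne_top)
  change c ≤ Z n ω
  by_contra! hlt
  have hbound : ∀ θ ∈ Lam, |objective φ (m n) p (fun t => Y t ω) n θ -
      Real.pi * limitObjective F p θ| < Real.pi * δ / 2 := fun θ hθ => by
    have h := (enorm_objective_sub_le φ hn hF h1 h2 hp hθ fun t => Y t ω).trans_lt hlt
    rw [Real.enorm_eq_ofReal_abs] at h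
    exact (ENNReal.ofReal_lt_ofReal_iff (by positivity)).mp h
  obtain ⟨he, hmin⟩ := hest n ω
  have hg := hgap _ he (by simpa [Real.dist_eq] using hω)
  have hm : objective φ (m n) p (fun t => Y t ω) n (est n ω) ≤
      objective φ (m n) p (fun t => Y t ω) n (spectralQuantile F p) := hmin hl
  have a1 := (abs_lt.mp (hbound _ he)).1
  have a2 := (abs_lt.mp (hbound _ hl)).2
  nlinarith

end Proc

end SpectralQuantile

end

/-! ### The consistency theorem -/

theorem theorem4p4 {Ω : Type*} [MeasurableSpace Ω] (P : Measure Ω) [IsProbabilityMeasure P]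
    -- the noise
    (X : ℤ → Ω → ℝ)
    (hX : SpectralQuantile.IsSecondOrderStationary P X)
    (hX4 : SpectralQuantile.HasSummableFourthCumulants P X)
    (FX : Measure ℝ)
    (hFX : SpectralQuantile.IsSpectralMeasure (SpectralQuantile.autocov P X) FX)
    (hFXcont : ∀ x : ℝ, FX {x} = 0)
    -- the sinusoids
    {J : ℕ} (R freq : Fin J → ℝ) (hR : ∃ j, R j ≠ 0)
    (hfreq : SpectralQuantile.AreProperFrequencies R freq)
    (Φ : Fin J → Ω → ℝ) (hΦ : SpectralQuantile.IsRandomPhase P X Φ)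
    -- the observed process and its spectral distribution
    (Y : ℤ → Ω → ℝ) (hY : Y = SpectralQuantile.sinusoidModel R freq Φ X)
    (FY : Measure ℝ)
    (hFY : SpectralQuantile.IsSpectralMeasure (SpectralQuantile.autocov P Y) FY)
    -- the level, with a uniquely determined quantile
    (p : ℝ) (hp : p ∈ Set.Icc (0 : ℝ) 1)
    (huniq : ∀ x ∈ SpectralQuantile.Lam, SpectralQuantile.spectralQuantile FY p < x →
      p * SpectralQuantile.spectralCDF FY Real.pi < SpectralQuantile.spectralCDF FY x)
    -- the window and the estimator
    (φ : ℝ → ℝ) (m : ℕ → ℕ) (hφ : SpectralQuantile.IsWindow φ m)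
    (est : ℕ → Ω → ℝ)
    (hest : ∀ n ω, est n ω ∈ SpectralQuantile.Lam ∧
      IsMinOn (SpectralQuantile.objective φ (m n) p (fun t => Y t ω) n)
        SpectralQuantile.Lam (est n ω)) :
    TendstoInMeasure P est atTop (fun _ => SpectralQuantile.spectralQuantile FY p) := by
  open SpectralQuantile in
  subst hY
  have hRY := autocov_sinusoidModel (R := R) (freq := freq) hX hΦ
  have hYm := measurable_sinusoidModel (R := R) (freq := freq) hX.measurable hΦ.measurable
  obtain ⟨h1, h2⟩ := spectral_mass_pi_eq_zero hfreq hFX hFXcont hFY hRY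
  obtain ⟨B, hBtop, hB⟩ := exists_lintegral_average_le (R := R) (freq := freq) hX hΦ.measurable
  -- The total mass is the variance of `Y_0`, to which a nonzero amplitude contributes `R_j² / 2`.
  have hpos : 0 < spectralCDF FY Real.pi := by
    have hX0 : 0 ≤ autocov P X 0 := by
      have := hX.integral_mul 0 0
      rw [sub_self] at this
      rw [← this]
      exact integral_nonneg fun ω => mul_self_nonneg _
    have hR0 : 0 < ∑ j, R j ^ 2 / 2 * Real.cos (freq j * (0 : ℤ)) := by
      obtain ⟨j, hj⟩ := hR
      refine Finset.sum_pos' (fun i _ => ?_) ⟨j, Finset.mem_univ _, ?_⟩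
      · simp; positivity
      · simp; positivity
    have hY0 := hFY.eq_integral_cos 0
    rw [hRY] at hY0
    rw [spectralCDF_pi hFY.support]
    have := hFY.finite
    simp only [Int.cast_zero, zero_mul, Real.cos_zero, integral_const, smul_eq_mul, mul_one] at hY0
    rw [← hY0]
    simp at hR0 ⊢
    linarith
  refine tendstoInMeasure_of_distance hYm hφ hFY h1 h2 hpos hp huniq
    (tendsto_lintegral_distance hYm hφ hFY hBtop hB fun h => ?_) hest
  rw [hRY]
  exact isL1Null_sinusoid_average hX hX4 hFX hFXcont hfreq hΦ.measurable h
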